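/- A \emph{tile} is a rhombus with side $1$ and angles $60^\circ$, $120^\circ$ whose sides are edges of the triangular lattice with unit edges in the plane (so there are three tile types, according to orientation). Two tiles are \emph{adjacent} if they share a side and \emph{neighbours} if they share at least one vertex. Let $T$ be a finite set of tiles. For a lattice direction $d$, consider the maximal chains of tiles of $T$ in which consecutive tiles share a side parallel to $d$; the \emph{runs} of $T$ are the chains of this kind, for any of the three directions, that contain at least two tiles. Let $\kappa \ge 2$ be an integer. A \emph{$\kappa$-doku tiling} is a nonempty finite set $T$ of tiles such that (1) no two tiles overlap (hence two tiles that touch either share exactly one vertex or share a side); (2) any two tiles of $T$ are joined by a sequence of tiles of $T$ in which consecutive tiles are adjacent; (3) after removal of any one tile, any two of the remaining tiles are still joined by a sequence of remaining tiles in which consecutive tiles are neighbours; (4) $T$ has no holes, that is, the complement in the plane of the union of the (closed) tiles is connected; (5) every run consists of exactly $\kappa$ tiles. A \emph{leaf} of $T$ is a tile that is adjacent to exactly one other tile of $T$. Then, for every $\kappa \ge 2$ and every $\kappa$-doku tiling with $\rho$ runs, the number $\lambda$ of leaves satisfies \[ 0 \le \lambda \le \begin{cases} \rho+3 & \text{if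 } \kappa \text{ is even and } \rho \text{ is odd},\\ \rho+2 & \text{otherwise.}\end{cases} \] -/

import Mathlib

namespace Doku

/-- Points of the triangular lattice of side length `1` in the plane: `(a, b)` stands for the point
`a • u₀ + b • u₁`, where `u₀`, `u₁` are unit vectors at an angle of 120 degrees. -/
abbrev Vertex := ℤ × ℤ

/-- The three lattice directions `u₀`, `u₁`, `u₂ = -u₀ - u₁`: unit vectors, any two of them at an
angle of 120 degrees. -/
def dir : Fin 3 → Vertex := ![(1, 0), (0, 1), (-1, -1)]

/-- The lattice edge `(q, j)` is the unit segment from `q` to `q + dir j`. Every lattice edge has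
exactly one such description, and two edges are parallel iff they have the same `j`. -/
abbrev Edge := Vertex × Fin 3

/-- `(q, true)` is the unit triangle `q, q + u₀, q + u₀ + u₁` and `(q, false)` is the unit triangle
`q, q + u₁, q + u₀ + u₁`. Every unit triangle of the lattice has exactly one such description. -/
abbrev Triangle := Vertex × Bool

/-- The three corners of a unit triangle. -/
def Triangle.vertices (t : Triangle) : Finset Vertex :=
  {t.1, t.1 + (if t.2 then dir 0 else dir 1), t.1 + dir 0 + dir 1}

/-- A tile: the rhombus of side `1` with angles of 60 and 120 degrees that is spanned at the vertex
`base` (where it has an angle of 120 degrees) by the two lattice directions other than `dir kind`.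
The three values of `kind` are the three tile types. -/
@[ext]
structure Tile where
  base : Vertex
  kind : Fin 3
deriving DecidableEq

/-- The four corners of a tile. -/
def Tile.vertices (A : Tile) : Finset Vertex :=
  {A.base, A.base + dir (A.kind + 1), A.base + dir (A.kind + 2),
    A.base + dir (A.kind + 1) + dir (A.kind + 2)}

/-- The four sides of a tile, two in each of the directions other than `kind`. -/
def Tile.sides (A : Tile) : Finset Edge :=
  {(A.base, A.kind + 1), (A.base + dir (A.kind + 2), A.kind + 1),
    (A.base, A.kind + 2), (A.base + dir (A.kind + 1), A.kind + 2)}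

/-- The tile `A` covers the unit triangle `t`. Each tile covers two triangles. -/
def Tile.Covers (A : Tile) (t : Triangle) : Prop :=
  Triangle.vertices t ⊆ A.vertices

instance (A : Tile) (t : Triangle) : Decidable (A.Covers t) :=
  inferInstanceAs (Decidable (Triangle.vertices t ⊆ A.vertices))

/-- Tiles are adjacent if they share a side. -/
def adjGraph : SimpleGraph Tile where
  Adj A B := A ≠ B ∧ ∃ e ∈ A.sides, e ∈ B.sides
  symm := ⟨fun _ _ h => ⟨h.1.symm, h.2.imp fun _ he => ⟨he.2, he.1⟩⟩⟩
  loopless := ⟨fun _ h => h.1 rfl⟩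

instance : DecidableRel adjGraph.Adj := fun A B =>
  inferInstanceAs (Decidable (A ≠ B ∧ ∃ e ∈ A.sides, e ∈ B.sides))

/-- Tiles are neighbours if they share at least one corner. -/
def nbrGraph : SimpleGraph Tile where
  Adj A B := A ≠ B ∧ ∃ v ∈ A.vertices, v ∈ B.vertices
  symm := ⟨fun _ _ h => ⟨h.1.symm, h.2.imp fun _ hv => ⟨hv.2, hv.1⟩⟩⟩
  loopless := ⟨fun _ h => h.1 rfl⟩

/-- Tiles are linked in direction `j` if they share a side parallel to `dir j`. -/
def stripGraph (j : Fin 3) : SimpleGraph Tile where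
  Adj A B := A ≠ B ∧ ∃ e ∈ A.sides, e ∈ B.sides ∧ e.2 = j
  symm := ⟨fun _ _ h => ⟨h.1.symm, h.2.imp fun _ he => ⟨he.2.1, he.1, he.2.2⟩⟩⟩
  loopless := ⟨fun _ h => h.1 rfl⟩

/-- Unit triangles are adjacent if they have a side in common. -/
def triangleGraph : SimpleGraph Triangle where
  Adj s t := (Triangle.vertices s ∩ Triangle.vertices t).card = 2
  symm := ⟨fun s t h => by rw [Finset.inter_comm]; exact h⟩
  loopless := ⟨fun t h => by
    obtain ⟨⟨a, b⟩, _ | _⟩ := t <;> simp [Triangle.vertices, dir] at h⟩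

/-- The maximal chains, in direction `j`, of tiles of `T` in which consecutive tiles share a side
parallel to `dir j`. -/
abbrev Strip (T : Finset Tile) (j : Fin 3) :=
  ((stripGraph j).induce (T : Set Tile)).ConnectedComponent

/-- The runs of `T`: the maximal chains, in any of the three directions, that consist of at least
two tiles. -/
abbrev Run (T : Finset Tile) :=
  Σ j : Fin 3, {c : Strip T j // c.supp.Nontrivial}

/-- The length of a run is the number of its tiles. -/
noncomputable def Run.length {T : Finset Tile} (r : Run T) : ℕ := r.2.1.supp.ncard

/-- The number of runs. -/
noncomputable def numRuns (T : Finset Tile) : ℕ := Nat.card (Run T)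

/-- A leaf is a tile that is adjacent to exactly one other tile. -/
def leaves (T : Finset Tile) : Finset Tile :=
  {A ∈ T | (({B ∈ T | adjGraph.Adj A B} : Finset Tile)).card = 1}

/-- `κ`-doku tilings (without holes). -/
structure IsDokuTiling (κ : ℕ) (T : Finset Tile) : Prop where
  /-- Tiles do not overlap. For lattice tiles this says that two tiles that touch either have just
  one vertex in common or have a side in common. -/
  no_overlap : ∀ A ∈ T, ∀ B ∈ T, A ≠ B → ∀ t, ¬ (A.Covers t ∧ B.Covers t)
  /-- The tiling is edge-connected. -/
  edge_connected : (adjGraph.induce (T : Set Tile)).Connected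
  /-- The tiling cannot be disconnected by removing one tile, where after the removal connection
  by just a vertex is allowed. -/
  two_connected : ∀ A ∈ T, (nbrGraph.induce ((T.erase A : Finset Tile) : Set Tile)).Preconnected
  /-- There are no holes: the complement of the union of the closed tiles is connected. This open
  set consists of the uncovered open triangles, the open edges both of whose sides are uncovered and
  the vertices all of whose six triangles are uncovered, so it is connected iff the uncovered
  triangles are connected through common sides. -/
  no_holes : (triangleGraph.induce {t : Triangle | ∀ A ∈ T, ¬ A.Covers t}).Preconnected
  /-- Every run consists of exactly `κ` tiles. -/
  run_length : ∀ r : Run T, r.length = κ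

end Doku

namespace Doku

/-! ### Triangles and edges around a vertex -/

/-! Write n, ρ, λ for the numbers of tiles, runs and leaves, with n ≥ 2. A flag is a tile with one
of its two side directions. A flag lies in a run unless both its sides are free, and `not_middle`
makes the free flags correspond to the leaves; hence κρ + λ = 2n (`mul_numRuns_add`). Each run and
each free flag has two boundary sides, so there are 2(ρ + λ) boundary edges and at most 2n + ρ + λ
edges in all. By `euler` there are at most n + ρ + λ + 1 vertices. Since 6n of the triangle
positions around them are covered, at most 6(ρ + λ + 1) are uncovered (`sum_outDeg_le`).

In the other direction, `four_mul_leaves_le` bounds the uncovered positions below by 4λ plus twice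
the number of blocks, and `le_sum_blocks` gives at least one block per boundary edge. So 4λ + 4(ρ +
λ) ≤ 6(ρ + λ + 1), that is, λ ≤ ρ + 3. Equality makes (κ + 1)ρ odd, by κρ + λ = 2n.

The lower bound is a discharging argument with the weight `outDeg - 2 * blocks`. The two outer
corners of a leaf carry at least 5. Elsewhere only notches, vertices with one uncovered triangle,
are negative, with weight -1. A walk around a corner of the notch (`exists_target`) sends each notch
injectively (`Target.unique`) to a leaf or to a vertex with at least three uncovered triangles.

Planarity enters through homology over the field with two elements: without holes, cycles are sums
of tile boundaries (`exists_chain`). Dually, functions on single tiles whose coboundaries agree on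
common sides can be glued (`exists_glued`). This yields `not_middle` and `no_pinch`, which says that
the covered triangles at a vertex form one block. -/

/-- The six unit vectors of the lattice, in counterclockwise order. -/
def hexDir : ZMod 6 → Vertex := ![(1, 0), (1, 1), (0, 1), (-1, 0), (-1, -1), (0, -1)]

/-- The base points of the six triangles at the origin are the `-triOff s`. -/
def triOff : ZMod 6 → Vertex := ![(0, 0), (0, 0), (1, 0), (1, 1), (1, 1), (0, 1)]

/-- The types of the six triangles at a vertex. -/
def triPar : ZMod 6 → Bool := ![true, false, true, false, true, false]

/-- The six triangles at the vertex `v`, in counterclockwise order: `tri v s` has the corners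
`v`, `v + hexDir s`, `v + hexDir (s + 1)`. -/
def tri (v : Vertex) (s : ZMod 6) : Triangle := (v - triOff s, triPar s)

/-- The base points of the six edges at the origin. -/
def edgeOff : ZMod 6 → Vertex := ![(0, 0), (1, 1), (0, 0), (-1, 0), (0, 0), (0, -1)]

/-- The directions of the six edges at a vertex. -/
def edgeKind : ZMod 6 → Fin 3 := ![0, 2, 1, 0, 2, 1]

/-- The edge from `v` to `v + hexDir s`. -/
def edgeAt (v : Vertex) (s : ZMod 6) : Edge := (v + edgeOff s, edgeKind s)

/-- The triangle of type `true` at the edge `(q, j)` is based at `q - upOff j`. -/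
def upOff : Fin 3 → Vertex := ![(0, 0), (1, 0), (1, 1)]

/-- The triangle of type `false` at the edge `(q, j)` is based at `q - dnOff j`. -/
def dnOff : Fin 3 → Vertex := ![(0, 1), (0, 0), (1, 1)]

/-- The triangle of type `true` at an edge. -/
def upTri (e : Edge) : Triangle := (e.1 - upOff e.2, true)

/-- The triangle of type `false` at an edge. -/
def dnTri (e : Edge) : Triangle := (e.1 - dnOff e.2, false)

/-- The end points of an edge. -/
def ends (e : Edge) : Finset Vertex := {e.1, e.1 + dir e.2}

/-- The short diagonal of a tile. -/
def Tile.diag (A : Tile) : Edge := (A.base - dir A.kind, A.kind)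

/-- The triangle of type `true` of a tile. -/
def Tile.up (A : Tile) : Triangle := upTri A.diag

/-- The triangle of type `false` of a tile. -/
def Tile.dn (A : Tile) : Triangle := dnTri A.diag

/-- Frees the later covering arguments from coordinates: a tile is its short diagonal with the two
triangles beside it. -/
theorem covers_iff (A : Tile) (t : Triangle) : A.Covers t ↔ t = A.up ∨ t = A.dn := by
  obtain ⟨⟨a, b⟩, k⟩ := A
  obtain ⟨⟨x, y⟩, c⟩ := t
  fin_cases k <;> cases c <;>
    simp [Tile.Covers, Tile.up, Tile.dn, Tile.diag, Tile.vertices, Triangle.vertices, upTri, dnTri, upOff, dnOff,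
      dir, Finset.insert_subset_iff, Prod.ext_iff] <;> omega

theorem mem_sides_iff (A : Tile) (e : Edge) :
    e ∈ A.sides ↔ e.2 ≠ A.kind ∧ (upTri e = A.up ∨ dnTri e = A.dn) := by
  obtain ⟨⟨a, b⟩, k⟩ := A
  obtain ⟨⟨x, y⟩, j⟩ := e
  fin_cases k <;> fin_cases j <;>
    simp [Tile.up, Tile.dn, Tile.diag, Tile.sides, upTri, dnTri, upOff, dnOff, dir, Prod.ext_iff] <;> omega

theorem edge_ext {e e' : Edge} (h1 : upTri e = upTri e') (h2 : dnTri e = dnTri e') : e = e' := by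
  obtain ⟨⟨a, b⟩, k⟩ := e
  obtain ⟨⟨x, y⟩, j⟩ := e'
  fin_cases k <;> fin_cases j <;> simp [upTri, dnTri, upOff, dnOff, Prod.ext_iff] at h1 h2 ⊢ <;> omega

theorem edge_ext_up {e e' : Edge} (h1 : upTri e = upTri e') (h2 : e.2 = e'.2) : e = e' := by
  obtain ⟨⟨a, b⟩, k⟩ := e
  obtain ⟨⟨x, y⟩, j⟩ := e'
  obtain rfl : k = j := h2
  exact Prod.ext (sub_left_injective (congrArg Prod.fst h1)) rfl

theorem edge_ext_dn {e e' : Edge} (h1 : dnTri e = dnTri e') (h2 : e.2 = e'.2) : e = e' := by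
  obtain ⟨⟨a, b⟩, k⟩ := e
  obtain ⟨⟨x, y⟩, j⟩ := e'
  obtain rfl : k = j := h2
  exact Prod.ext (sub_left_injective (congrArg Prod.fst h1)) rfl

theorem diag_up (A : Tile) : upTri A.diag = A.up := rfl
theorem diag_dn (A : Tile) : dnTri A.diag = A.dn := rfl

/-- Adjacent triangles are the two triangles of an edge. -/
theorem triangle_adj {t t' : Triangle} (h : triangleGraph.Adj t t') :
    ∃ e : Edge, (t = upTri e ∧ t' = dnTri e) ∨ (t = dnTri e ∧ t' = upTri e) := by
  have h1 : 1 < (Triangle.vertices t ∩ Triangle.vertices t').card := by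
    have : (Triangle.vertices t ∩ Triangle.vertices t').card = 2 := h
    omega
  have hne : t ≠ t' := h.ne
  obtain ⟨p, hp, q, hq, hpq⟩ := Finset.one_lt_card.mp h1
  obtain ⟨⟨a, b⟩, c⟩ := t
  obtain ⟨⟨x, y⟩, d⟩ := t'
  obtain ⟨p1, p2⟩ := p
  obtain ⟨q1, q2⟩ := q
  cases c <;> cases d
  · exfalso
    simp [Triangle.vertices, dir, Prod.ext_iff] at hp hq hpq hne
    omega
  · have : (x = a ∧ y = b + 1) ∨ (x = a - 1 ∧ y = b) ∨ (x = a ∧ y = b) := by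
      simp [Triangle.vertices, dir, Prod.ext_iff] at hp hq hpq
      omega
    rcases this with ⟨rfl, rfl⟩ | ⟨rfl, rfl⟩ | ⟨rfl, rfl⟩
    · exact ⟨((x, b + 1), 0), Or.inr (by simp [upTri, dnTri, upOff, dnOff])⟩
    · exact ⟨((a, y), 1), Or.inr (by simp [upTri, dnTri, upOff, dnOff])⟩
    · exact ⟨((x + 1, y + 1), 2), Or.inr (by simp [upTri, dnTri, upOff, dnOff])⟩
  · have : (x = a ∧ y = b - 1) ∨ (x = a + 1 ∧ y = b) ∨ (x = a ∧ y = b) := by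
      simp [Triangle.vertices, dir, Prod.ext_iff] at hp hq hpq
      omega
    rcases this with ⟨rfl, rfl⟩ | ⟨rfl, rfl⟩ | ⟨rfl, rfl⟩
    · exact ⟨((x, b), 0), Or.inl (by simp [upTri, dnTri, upOff, dnOff])⟩
    · exact ⟨((a + 1, y), 1), Or.inl (by simp [upTri, dnTri, upOff, dnOff])⟩
    · exact ⟨((x + 1, y + 1), 2), Or.inl (by simp [upTri, dnTri, upOff, dnOff])⟩
  · exfalso
    simp [Triangle.vertices, dir, Prod.ext_iff] at hp hq hpq hne
    omega

/-! ### Rotation about a vertex -/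

theorem hexDir_add_three (s : ZMod 6) : hexDir (s + 3) = -hexDir s := by
  revert s; decide

theorem hexDir_add_two (s : ZMod 6) : hexDir s + hexDir (s + 2) = hexDir (s + 1) := by
  revert s; decide

theorem hexDir_sub (s : ZMod 6) : hexDir s - triOff (s + 2) = -triOff s := by
  revert s; decide

theorem triPar_add_two (s : ZMod 6) : triPar (s + 2) = triPar s := by
  revert s; decide

/-- Passing to the next corner of a triangle counterclockwise turns its angle by 120 degrees, two
steps of the index. -/
theorem tri_hexDir (v : Vertex) (s : ZMod 6) : tri (v + hexDir s) (s + 2) = tri v s := by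
  refine Prod.ext ?_ (triPar_add_two s)
  simp only [tri]
  rw [add_sub_assoc, hexDir_sub, sub_eq_add_neg]

theorem tri_hexDir_succ (v : Vertex) (s : ZMod 6) :
    tri (v + hexDir (s + 1)) (s + 4) = tri v s := by
  rw [← tri_hexDir v s, ← tri_hexDir (v + hexDir s) (s + 2), add_assoc v, hexDir_add_two]
  ring_nf

theorem edgeOff_sub (s : ZMod 6) :
    (edgeOff s - upOff (edgeKind s) = -triOff s ∧ edgeOff s - dnOff (edgeKind s) = -triOff (s - 1) ∧
      triPar s = true ∧ triPar (s - 1) = false) ∨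
    (edgeOff s - upOff (edgeKind s) = -triOff (s - 1) ∧ edgeOff s - dnOff (edgeKind s) = -triOff s ∧
      triPar s = false ∧ triPar (s - 1) = true) := by
  revert s; decide

/-- The triangles on the two sides of an edge at `v`. -/
theorem edgeAt_tri (v : Vertex) (s : ZMod 6) :
    (upTri (edgeAt v s) = tri v s ∧ dnTri (edgeAt v s) = tri v (s - 1)) ∨
      (upTri (edgeAt v s) = tri v (s - 1) ∧ dnTri (edgeAt v s) = tri v s) := by
  rcases edgeOff_sub s with ⟨h1, h2, h3, h4⟩ | ⟨h1, h2, h3, h4⟩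
  · left
    constructor
    · simp only [upTri, edgeAt, tri, add_sub_assoc, h1, h3, sub_eq_add_neg v]
    · simp only [dnTri, edgeAt, tri, add_sub_assoc, h2, h4, sub_eq_add_neg v]
  · right
    constructor
    · simp only [upTri, edgeAt, tri, add_sub_assoc, h1, h4, sub_eq_add_neg v]
    · simp only [dnTri, edgeAt, tri, add_sub_assoc, h2, h3, sub_eq_add_neg v]

theorem tri_injective (v : Vertex) : Function.Injective (tri v) := by
  intro s s' h
  have key : ∀ s s' : ZMod 6, triOff s = triOff s' → triPar s = triPar s' → s = s' := by decide
  exact key s s' (sub_right_injective (congrArg Prod.fst h)) (congrArg Prod.snd h)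

theorem edgeAt_injective (v : Vertex) : Function.Injective (edgeAt v) := by
  intro s s' h
  have key : ∀ s s' : ZMod 6, edgeOff s = edgeOff s' → edgeKind s = edgeKind s' → s = s' := by
    decide
  exact key s s' (add_right_injective v (congrArg Prod.fst h)) (congrArg Prod.snd h)

theorem edgeAt_ends (v : Vertex) (s : ZMod 6) : ends (edgeAt v s) = {v, v + hexDir s} := by
  have h : (edgeOff s = 0 ∧ dir (edgeKind s) = hexDir s) ∨
      (edgeOff s = hexDir s ∧ hexDir s + dir (edgeKind s) = 0) := by
    revert s; decide
  rcases h with ⟨h1, h2⟩ | ⟨h1, h2⟩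
  · simp only [ends, edgeAt, h1, h2, add_zero]
  · simp only [ends, edgeAt, h1, add_assoc, h2, add_zero]
    exact Finset.pair_comm _ _

theorem mem_ends_iff (v : Vertex) (e : Edge) : v ∈ ends e ↔ ∃ s, e = edgeAt v s := by
  constructor
  · obtain ⟨q, j⟩ := e
    intro h
    simp only [ends, Finset.mem_insert, Finset.mem_singleton] at h
    rcases h with rfl | rfl
    · have : ∃ s, edgeOff s = 0 ∧ edgeKind s = j := by revert j; decide
      obtain ⟨s, h1, h2⟩ := this
      exact ⟨s, by simp only [edgeAt, h1, h2, add_zero]⟩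
    · have : ∃ s, dir j + edgeOff s = 0 ∧ edgeKind s = j := by revert j; decide
      obtain ⟨s, h1, h2⟩ := this
      exact ⟨s, by simp only [edgeAt, h2, add_assoc, h1, add_zero]⟩
  · rintro ⟨s, rfl⟩
    simp [edgeAt_ends]

theorem edgeAt_hexDir (v : Vertex) (s : ZMod 6) : edgeAt (v + hexDir s) (s + 3) = edgeAt v s := by
  have h : hexDir s + edgeOff (s + 3) = edgeOff s ∧ edgeKind (s + 3) = edgeKind s := by
    revert s; decide
  simp only [edgeAt, add_assoc, h.1, h.2]

theorem tri_vertices (v : Vertex) (s : ZMod 6) :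
    Triangle.vertices (tri v s) = {v, v + hexDir s, v + hexDir (s + 1)} := by
  have h : ∀ s : ZMod 6, ({-triOff s, -triOff s + (if triPar s then dir 0 else dir 1),
      -triOff s + (dir 0 + dir 1)} : Finset Vertex) = {0, hexDir s, hexDir (s + 1)} := by
    decide
  have h' := congrArg (Finset.image (v + ·)) (h s)
  simpa [Triangle.vertices, tri, Finset.image_insert, sub_eq_add_neg, add_assoc] using h'

theorem exists_tri {v : Vertex} {t : Triangle} (h : v ∈ Triangle.vertices t) :
    ∃ s, t = tri v s := by
  obtain ⟨q, c⟩ := t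
  have h' : v - q ∈ ({0, (if c then dir 0 else dir 1), dir 0 + dir 1} : Finset Vertex) := by
    simp only [Triangle.vertices, Finset.mem_insert, Finset.mem_singleton] at h ⊢
    rcases h with rfl | rfl | rfl
    · left; simp
    · right; left; simp
    · right; right; abel
  have key : ∀ c : Bool, ∀ w ∈ ({0, (if c then dir 0 else dir 1), dir 0 + dir 1} : Finset Vertex),
      ∃ s, triOff s = w ∧ triPar s = c := by decide
  obtain ⟨s, h1, h2⟩ := key c _ h'
  exact ⟨s, by simp only [tri, h1, h2, sub_sub_cancel]⟩

theorem mem_tri (v : Vertex) (s : ZMod 6) : v ∈ Triangle.vertices (tri v s) := by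
  simp [tri_vertices]

/-- The corners of a tile are the corners of its two triangles. -/
theorem mem_vertices_iff (A : Tile) (v : Vertex) :
    v ∈ A.vertices ↔ v ∈ Triangle.vertices A.up ∨ v ∈ Triangle.vertices A.dn := by
  obtain ⟨⟨a, b⟩, k⟩ := A
  obtain ⟨x, y⟩ := v
  fin_cases k <;>
    simp [Tile.up, Tile.dn, Tile.diag, Tile.vertices, Triangle.vertices, upTri, dnTri, upOff, dnOff,
      dir, Prod.ext_iff] <;> omega

theorem mem_vertices_iff_tri (A : Tile) (v : Vertex) :
    v ∈ A.vertices ↔ ∃ s, A.Covers (tri v s) := by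
  simp only [mem_vertices_iff, covers_iff]
  constructor
  · rintro (h | h) <;> obtain ⟨s, hs⟩ := exists_tri h
    exacts [⟨s, Or.inl hs.symm⟩, ⟨s, Or.inr hs.symm⟩]
  · rintro ⟨s, h | h⟩ <;> rw [← h]
    exacts [Or.inl (mem_tri v s), Or.inr (mem_tri v s)]

theorem ends_subset {A : Tile} {e : Edge} (h : e ∈ A.sides) : ends e ⊆ A.vertices := by
  obtain ⟨q, k⟩ := A
  simp only [Tile.sides, Finset.mem_insert, Finset.mem_singleton] at h
  rcases h with rfl | rfl | rfl | rfl <;> intro v hv <;>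
    simp only [ends, Finset.mem_insert, Finset.mem_singleton] at hv <;>
    simp only [Tile.vertices, Finset.mem_insert, Finset.mem_singleton]
  · tauto
  · rcases hv with rfl | rfl
    · tauto
    · right; right; right; abel
  · tauto
  · tauto

theorem mem_sides_edgeAt (A : Tile) (v : Vertex) (s : ZMod 6) :
    edgeAt v s ∈ A.sides ↔ edgeKind s ≠ A.kind ∧ (A.Covers (tri v s) ∨ A.Covers (tri v (s - 1))) := by
  have hud : ∀ e e' : Edge, upTri e ≠ dnTri e' := fun e e' h => by simp [upTri, dnTri] at h
  rw [mem_sides_iff]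
  refine and_congr Iff.rfl ?_
  simp only [covers_iff]
  rcases edgeAt_tri v s with ⟨h1, h2⟩ | ⟨h1, h2⟩ <;> rw [← h1, ← h2, Tile.up, Tile.dn] <;>
    simp [hud, (hud _ _).symm]
  exact or_comm

/-! ### Tilings without overlap -/

/-- A unit triangle is covered by a set of tiles. -/
def Cov (T : Finset Tile) (t : Triangle) : Prop := ∃ A ∈ T, A.Covers t

instance (T : Finset Tile) (t : Triangle) : Decidable (Cov T t) :=
  inferInstanceAs (Decidable (∃ A ∈ T, A.Covers t))

/-- The edges of a set of tiles. -/
def edges (T : Finset Tile) : Finset Edge := T.biUnion Tile.sides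

/-- The vertices of a set of tiles. -/
def verts (T : Finset Tile) : Finset Vertex := T.biUnion Tile.vertices

theorem mem_edges {T : Finset Tile} {e : Edge} : e ∈ edges T ↔ ∃ A ∈ T, e ∈ A.sides := by
  simp [edges]

theorem mem_verts {T : Finset Tile} {v : Vertex} : v ∈ verts T ↔ ∃ A ∈ T, v ∈ A.vertices := by
  simp [verts]

theorem upTri_ne_dnTri (e e' : Edge) : upTri e ≠ dnTri e' := fun h => by simp [upTri, dnTri] at h

theorem covers_upTri (A : Tile) (e : Edge) : A.Covers (upTri e) ↔ upTri e = A.up := by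
  rw [covers_iff, or_iff_left]
  exact upTri_ne_dnTri _ _

theorem covers_dnTri (A : Tile) (e : Edge) : A.Covers (dnTri e) ↔ dnTri e = A.dn := by
  rw [covers_iff, or_iff_right]
  exact (upTri_ne_dnTri _ _).symm

/-- The sides of a tile are the edges that have just one of their triangles in the tile. -/
theorem mem_sides_iff_xor (A : Tile) (e : Edge) :
    e ∈ A.sides ↔ Xor (A.Covers (upTri e)) (A.Covers (dnTri e)) := by
  rw [mem_sides_iff, covers_upTri, covers_dnTri]
  by_cases hk : e.2 = A.kind
  · have h : upTri e = A.up ↔ dnTri e = A.dn := by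
      constructor <;> intro h
      · rw [edge_ext_up (e' := A.diag) h hk]; rfl
      · rw [edge_ext_dn (e' := A.diag) h hk]; rfl
    simp [hk, h]
  · have h : ¬ (upTri e = A.up ∧ dnTri e = A.dn) := fun h =>
      hk (congrArg Prod.snd (edge_ext (e' := A.diag) h.1 h.2))
    simp only [Xor]
    tauto

/-- Provides an uncovered region far to the right, where potentials vanish and from which holes are
detected. -/
theorem exists_bound (T : Finset Tile) : ∃ M : ℤ, ∀ t, Cov T t → t.1.1 < M := by
  obtain ⟨M, hM⟩ := (T.image (fun A => A.up.1.1) ∪ T.image (fun A => A.dn.1.1)).bddAbove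
  refine ⟨M + 1, ?_⟩
  rintro t ⟨A, hA, ht⟩
  rw [covers_iff] at ht
  have : t.1.1 ≤ M := hM <| by
    simp only [Finset.coe_union, Finset.coe_image, Set.mem_union, Set.mem_image, Finset.mem_coe]
    rcases ht with rfl | rfl
    exacts [Or.inl ⟨A, hA, rfl⟩, Or.inr ⟨A, hA, rfl⟩]
  omega

theorem cov_of_mem_edges {T : Finset Tile} {e : Edge} (h : e ∈ edges T) :
    Cov T (upTri e) ∨ Cov T (dnTri e) := by
  obtain ⟨A, hA, he⟩ := mem_edges.mp h
  rcases ((mem_sides_iff_xor A e).mp he).or with h | h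
  exacts [Or.inl ⟨A, hA, h⟩, Or.inr ⟨A, hA, h⟩]

/-- Distinct tiles do not overlap. -/
def NoOverlap (T : Finset Tile) : Prop :=
  ∀ A ∈ T, ∀ B ∈ T, A ≠ B → ∀ t, ¬ (A.Covers t ∧ B.Covers t)

theorem NoOverlap.unique {T : Finset Tile} (hT : NoOverlap T) {A B : Tile} (hA : A ∈ T)
    (hB : B ∈ T) {t : Triangle} (h1 : A.Covers t) (h2 : B.Covers t) : A = B := by
  by_contra h
  exact hT A hA B hB h t ⟨h1, h2⟩

/-- The complement of the tiles is connected. -/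
def NoHoles (T : Finset Tile) : Prop :=
  (triangleGraph.induce {t : Triangle | ∀ A ∈ T, ¬ A.Covers t}).Preconnected

/-- A property of uncovered triangles that passes to adjacent ones holds for all of them, once it
holds for one. -/
theorem NoHoles.induction {T : Finset Tile} (hT : NoHoles T) {P : Triangle → Prop}
    (hP : ∀ t t', ¬ Cov T t → ¬ Cov T t' → triangleGraph.Adj t t' → P t → P t') {t₀ : Triangle}
    (h₀ : ¬ Cov T t₀) (h₁ : P t₀) {t : Triangle} (ht : ¬ Cov T t) : P t := by
  have hc : ∀ {t}, ¬ Cov T t → t ∈ {t : Triangle | ∀ A ∈ T, ¬ A.Covers t} := fun h A hA hh =>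
    h ⟨A, hA, hh⟩
  obtain ⟨w⟩ := hT ⟨t₀, hc h₀⟩ ⟨t, hc ht⟩
  have key : ∀ {x y : {t : Triangle | ∀ A ∈ T, ¬ A.Covers t}},
      (triangleGraph.induce {t : Triangle | ∀ A ∈ T, ¬ A.Covers t}).Walk x y → P x → P y := by
    intro x y w
    induction w with
    | nil => exact id
    | @cons x y z h _ ih =>
      refine fun hx => ih (hP x y ?_ ?_ h hx)
      · rintro ⟨A, hA, hh⟩; exact x.2 A hA hh
      · rintro ⟨A, hA, hh⟩; exact y.2 A hA hh
  exact key w h₁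

/-! ### Cycles of edges are sums of tile boundaries -/

section Homology

variable {T : Finset Tile}

/-- Potentials: sums over the tiles that cover a triangle. -/
theorem sum_covers (T : Finset Tile) (c : Tile → ZMod 2) (e : Edge) :
    (∑ A ∈ T, if e ∈ A.sides then c A else 0) =
      (∑ A ∈ T, if A.Covers (upTri e) then c A else 0) +
        ∑ A ∈ T, if A.Covers (dnTri e) then c A else 0 := by
  rw [← Finset.sum_add_distrib]
  refine Finset.sum_congr rfl fun A _ => ?_
  simp only [mem_sides_iff_xor]
  by_cases h1 : A.Covers (upTri e) <;> by_cases h2 : A.Covers (dnTri e) <;>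
    simp [h1, h2, Xor, CharTwo.add_self_eq_zero]

theorem sum_covers_eq (hT : NoOverlap T) (c : Tile → ZMod 2) {A : Tile} (hA : A ∈ T)
    {t : Triangle} (h : A.Covers t) : (∑ B ∈ T, if B.Covers t then c B else 0) = c A := by
  rw [Finset.sum_eq_single A]
  · simp [h]
  · intro B hB hne
    rw [if_neg]
    exact fun h' => hne (hT.unique hB hA h' h)
  · exact fun h' => absurd hA h'

theorem sum_covers_eq_zero (c : Tile → ZMod 2) {t : Triangle} (h : ¬ Cov T t) :
    (∑ B ∈ T, if B.Covers t then c B else 0) = 0 :=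
  Finset.sum_eq_zero fun B hB => if_neg fun h' => h ⟨B, hB, h'⟩

/-- The boundary map from tiles to edges is injective. -/
theorem boundary_injective (hT : NoOverlap T) (c : Tile → ZMod 2)
    (hc : ∀ e, (∑ A ∈ T, if e ∈ A.sides then c A else 0) = 0) : ∀ A ∈ T, c A = 0 := by
  set S : Triangle → ZMod 2 := fun t => ∑ A ∈ T, if A.Covers t then c A else 0 with hS
  have h : ∀ e, S (upTri e) = S (dnTri e) := fun e => by
    have := hc e
    rw [sum_covers] at this
    exact CharTwo.add_eq_zero.mp this
  -- Crossing edges of directions 2 and 1 moves along a row, so `S` is constant on each row and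
  -- takes its value 0 from the far right.
  have h1 : ∀ a b : ℤ, S ((a, b), true) = S ((a, b), false) := fun a b => by
    simpa [upTri, dnTri, upOff, dnOff] using h ((a + 1, b + 1), 2)
  have h2 : ∀ a b : ℤ, S ((a, b), true) = S ((a + 1, b), true) := fun a b => by
    have := h ((a + 1, b), 1)
    simp only [upTri, dnTri, upOff, dnOff] at this
    simp at this
    rw [this, h1]
  obtain ⟨M, hM⟩ := exists_bound T
  have h3 : ∀ (k : ℕ) (a b : ℤ), S ((a, b), true) = S ((a + k, b), true) := by
    intro k
    induction k with
    | zero => simp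
    | succ k ih => intro a b; rw [ih, h2]; push_cast; ring_nf
  have h4 : ∀ a b : ℤ, S ((a, b), true) = 0 := fun a b => by
    rw [h3 (M - a).toNat]
    refine sum_covers_eq_zero c fun h => ?_
    have := hM _ h
    simp only at this
    omega
  intro A hA
  rw [← sum_covers_eq hT c hA ((covers_iff A A.up).mpr (Or.inl rfl))]
  exact h4 _ _

theorem sum_zmod6 (f : ZMod 6 → ZMod 2) : ∑ s, f s = f 0 + f 1 + f 2 + f 3 + f 4 + f 5 :=
  Fin.sum_univ_six f

/-- A cycle bounds a set of triangles. -/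
theorem exists_potential {z : Edge → ZMod 2} {M : ℤ} (hM : ∀ e, M < e.1.1 → z e = 0)
    (hz : ∀ v, ∑ s, z (edgeAt v s) = 0) :
    ∃ S : Triangle → ZMod 2, (∀ e, z e = S (upTri e) + S (dnTri e)) ∧
      ∀ t : Triangle, M ≤ t.1.1 → S t = 0 := by
  -- The sum of `z` over the edges crossed on the way from the triangle `((a, b), true)` to the
  -- right along its row.
  set U : ℤ → ℤ → ZMod 2 := fun a b =>
    ∑ x ∈ Finset.Ioc a M, (z ((x, b), 1) + z ((x + 1, b + 1), 2)) with hU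
  have hrec : ∀ a b, U a b = z ((a + 1, b), 1) + z ((a + 2, b + 1), 2) + U (a + 1) b := by
    intro a b
    by_cases h : a < M
    · have : Finset.Ioc a M = insert (a + 1) (Finset.Ioc (a + 1) M) := by
        ext x; simp only [Finset.mem_Ioc, Finset.mem_insert]; omega
      simp only [hU]
      rw [this, Finset.sum_insert (by simp)]
      ring_nf
    · simp only [hU]
      rw [Finset.Ioc_eq_empty (by omega), Finset.Ioc_eq_empty (by omega), hM _ (by simp; omega),
        hM _ (by simp; omega)]
      simp
  have hU0 : ∀ a b, M ≤ a → U a b = 0 := fun a b h => by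
    simp only [hU]; rw [Finset.Ioc_eq_empty (by omega)]; simp
  -- Edges of direction 0 separate rows, so the definition of `U` does not see them. They are
  -- treated by descent in `a` from the region where `z` vanishes; the step uses the cycle condition
  -- at `(a + 1, b)`.
  have hzero : ∀ (k : ℕ) (a b : ℤ), M - a < k →
      z ((a, b), 0) = U a b + (z ((a + 1, b), 2) + U a (b - 1)) := by
    intro k
    induction k with
    | zero =>
      intro a b h
      have h' : M < a := by simpa using h
      rw [hU0 a _ h'.le, hU0 a _ h'.le, hM _ h', hM _ (by simp; omega)]
      simp
    | succ k ih =>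
      intro a b h
      have h1 := ih (a + 1) b (by push_cast at h; omega)
      have h2 := hz (a + 1, b)
      have h3 := hrec a (b - 1)
      have two : (2 : ZMod 2) = 0 := rfl
      rw [sum_zmod6] at h2
      simp [edgeAt, edgeOff, edgeKind] at h2
      rw [sub_add_cancel] at h3
      rw [hrec a b, h3]
      rw [← sub_eq_add_neg, show a + 1 + 1 = a + 2 by ring] at h2
      rw [show a + 1 + 1 = a + 2 by ring] at h1
      linear_combination h1 - h2 + z ((a, b), 0) * two
  refine ⟨fun t => if t.2 then U t.1.1 t.1.2 else z ((t.1.1 + 1, t.1.2 + 1), 2) + U t.1.1 t.1.2,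
    ?_, ?_⟩
  · rintro ⟨⟨a, b⟩, j⟩
    fin_cases j
    · simpa [upTri, dnTri, upOff, dnOff] using hzero ((M - a).toNat + 1) a b (by push_cast; omega)
    · have h := hrec (a - 1) b
      have e1 : a - 1 + 1 = a := by ring
      have e2 : a - 1 + 2 = a + 1 := by ring
      rw [e1, e2] at h
      simp [upTri, dnTri, upOff, dnOff, h]
      linear_combination - CharTwo.add_self_eq_zero (z ((a + 1, b + 1), 2)) -
        CharTwo.add_self_eq_zero (U a b)
    · simp [upTri, dnTri, upOff, dnOff]
      linear_combination - CharTwo.add_self_eq_zero (U (a - 1) (b - 1))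
  · rintro ⟨⟨a, b⟩, c⟩ h
    simp only at h
    simp only [hU0 a b h, hM ((a + 1, b + 1), 2) (by simp; omega)]
    simp

/-- Every cycle of edges of `T` is a sum of boundaries of tiles. -/
theorem exists_chain (hT : NoOverlap T) (hT' : NoHoles T) {z : Edge → ZMod 2}
    (hE : ∀ e, e ∉ edges T → z e = 0) (hz : ∀ v, ∑ s, z (edgeAt v s) = 0) :
    ∃ c : Tile → ZMod 2, ∀ e, z e = ∑ A ∈ T, if e ∈ A.sides then c A else 0 := by
  obtain ⟨M, hM⟩ := exists_bound T
  obtain ⟨S, hS, hS0⟩ := exists_potential (z := z) (M := M + 1) (by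
    rintro ⟨⟨a, b⟩, j⟩ h
    refine hE _ fun h' => ?_
    rcases cov_of_mem_edges h' with h' | h' <;> have := hM _ h' <;> revert this h <;>
      fin_cases j <;> simp [upTri, dnTri, upOff, dnOff] <;> omega) hz
  -- The potential does not change across an edge outside `T`; without holes, its value 0 at the far
  -- right reaches all uncovered triangles.
  have hunc : ∀ t, ¬ Cov T t → S t = 0 := by
    intro t ht
    refine hT'.induction (P := fun t => S t = 0) ?_ (t₀ := ((M + 1, 0), true))
      (fun h => ?_) (hS0 _ le_rfl) ht
    · intro t t' h h' hadj hSt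
      obtain ⟨e, ⟨rfl, rfl⟩ | ⟨rfl, rfl⟩⟩ := triangle_adj hadj
      all_goals
        have he : e ∉ edges T := fun he => by
          rcases cov_of_mem_edges he with h1 | h1 <;> contradiction
        have := hS e
        rw [hE e he, hSt] at this
        simpa using this.symm
    · have := hM _ h
      simp only at this
      omega
  refine ⟨fun A => S A.up, fun e => ?_⟩
  have key : ∀ t, (∑ A ∈ T, if A.Covers t then S A.up else 0) = S t := by
    intro t
    by_cases ht : Cov T t
    · obtain ⟨A, hA, h⟩ := ht
      rw [sum_covers_eq hT _ hA h]
      rcases (covers_iff A t).mp h with rfl | rfl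
      · rfl
      -- The short diagonal of `A` is a side of no tile, so `z` vanishes on it and both halves of
      -- `A` have the same potential.
      · have hd : A.diag ∉ edges T := fun hd => by
          obtain ⟨B, hB, h'⟩ := mem_edges.mp hd
          have : A = B := by
            rcases ((mem_sides_iff_xor B _).mp h').or with h' | h'
            · exact hT.unique hA hB ((covers_iff A _).mpr (Or.inl rfl)) h'
            · exact hT.unique hA hB h h'
          subst this
          exact ((mem_sides_iff A _).mp h').1 rfl
        have := hS A.diag
        rw [hE _ hd] at this
        exact CharTwo.add_eq_zero.mp this.symm
    · rw [sum_covers_eq_zero _ ht, hunc t ht]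
  rw [sum_covers, key, key, hS]

end Homology

/-! ### Gluing functions on tiles, and Euler's inequality -/

section Cohomology

variable {T : Finset Tile}

/-- The range of a dual map is the annihilator of the kernel. This turns "cycles are boundaries"
into "cocycles are coboundaries". -/
theorem exists_factor {F E V : Type*} [Field F] [AddCommGroup E] [Module F E] [AddCommGroup V]
    [Module F V] (f : E →ₗ[F] V) (φ : E →ₗ[F] F) (h : ∀ x, f x = 0 → φ x = 0) :
    ∃ ψ : V →ₗ[F] F, ∀ x, ψ (f x) = φ x := by
  have hker : φ ∈ (LinearMap.ker f).dualAnnihilator :=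
    (Submodule.mem_dualAnnihilator _).mpr h
  rw [← LinearMap.range_dualMap_eq_dualAnnihilator_ker] at hker
  obtain ⟨ψ, hψ⟩ := hker
  exact ⟨ψ, LinearMap.congr_fun hψ⟩

/-- Rank-nullity, for a kernel that contains an injective image; for Euler's inequality this image
is spanned by the tile boundaries. -/
theorem finrank_le_of_image {F E V : Type*} [Field F] [AddCommGroup E] [Module F E]
    [Module.Finite F E] [AddCommGroup V] [Module F V] (f : E →ₗ[F] V) {ι : Type*} [Fintype ι]
    (b : (ι → F) →ₗ[F] E) (hb : Function.Injective b) (hfb : ∀ x, f (b x) = 0) :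
    Module.finrank F (LinearMap.range f) + Fintype.card ι ≤ Module.finrank F E := by
  rw [← LinearMap.finrank_range_add_finrank_ker f]
  gcongr
  calc Fintype.card ι = Module.finrank F (ι → F) := by simp
    _ ≤ _ := LinearMap.finrank_le_finrank_of_injective
      (f := b.codRestrict (LinearMap.ker f) hfb) fun x y h => hb (congrArg Subtype.val h)

/-- The second end point of an edge. -/
def Edge.tip (e : Edge) : Vertex := e.1 + dir e.2

theorem Edge.tip_ne (e : Edge) : e.1 ≠ Edge.tip e := by
  have : ∀ j, dir j ≠ 0 := by decide
  simpa [Edge.tip] using this e.2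

theorem mem_ends {v : Vertex} {e : Edge} : v ∈ ends e ↔ v = e.1 ∨ v = Edge.tip e := by
  simp [ends, Edge.tip]

theorem sum_sides (A : Tile) {M : Type*} [AddCommMonoid M] (F : Edge → M) :
    ∑ e ∈ A.sides, F e = F (A.base, A.kind + 1) + (F (A.base + dir (A.kind + 2), A.kind + 1) +
      (F (A.base, A.kind + 2) + F (A.base + dir (A.kind + 1), A.kind + 2))) := by
  obtain ⟨q, k⟩ := A
  have h1 : ∀ k : Fin 3, k + 1 ≠ k + 2 := by decide
  have h2 : ∀ j : Fin 3, dir j ≠ 0 := by decide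
  rw [Tile.sides, Finset.sum_insert, Finset.sum_insert, Finset.sum_insert, Finset.sum_singleton]
  all_goals simp [h1, h2, Prod.ext_iff]

theorem sum_sides_eq_zero (A : Tile) (f : Vertex → ZMod 2) :
    ∑ e ∈ A.sides, (f e.1 + f (Edge.tip e)) = 0 := by
  rw [sum_sides]
  simp only [Edge.tip]
  rw [add_right_comm A.base (dir (A.kind + 2)) (dir (A.kind + 1))]
  have two : (2 : ZMod 2) = 0 := rfl
  linear_combination (f A.base + f (A.base + dir (A.kind + 1)) + f (A.base + dir (A.kind + 2)) +
    f (A.base + dir (A.kind + 1) + dir (A.kind + 2))) * two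

/-- The boundary map from edges to vertices. -/
noncomputable def bdry : (Edge →₀ ZMod 2) →ₗ[ZMod 2] (Vertex →₀ ZMod 2) :=
  Finsupp.linearCombination (ZMod 2)
    fun e => Finsupp.single e.1 1 + Finsupp.single (Edge.tip e) 1

theorem bdry_single (e : Edge) :
    bdry (Finsupp.single e 1) = Finsupp.single e.1 1 + Finsupp.single (Edge.tip e) 1 := by
  simp [bdry]

/-- Translates the kernel of `bdry` into the vertex condition of `exists_chain`. -/
theorem bdry_apply (z : Edge →₀ ZMod 2) (v : Vertex) : bdry z v = ∑ s, z (edgeAt v s) := by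
  induction z using Finsupp.induction_linear with
  | zero => simp
  | add f g hf hg => simp [hf, hg, Finset.sum_add_distrib]
  | single e c =>
    simp only [bdry, Finsupp.linearCombination_single, Finsupp.smul_apply, Finsupp.add_apply,
      Finsupp.single_apply, smul_eq_mul]
    by_cases h : v ∈ ends e
    · obtain ⟨s, hs⟩ := (mem_ends_iff v e).mp h
      rw [Finset.sum_eq_single s]
      · rcases mem_ends.mp h with h | h
        · rw [if_pos h.symm, if_neg, if_pos hs]
          · simp
          · rw [h]; exact (Edge.tip_ne e).symm
        · rw [if_neg, if_pos h.symm, if_pos hs]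
          · simp
          · rw [h]; exact Edge.tip_ne e
      · exact fun s' _ hne => if_neg fun h' => hne (edgeAt_injective v (h'.symm.trans hs))
      · simp
    · rw [Finset.sum_eq_zero]
      · rw [mem_ends, not_or] at h
        rw [if_neg (Ne.symm h.1), if_neg (Ne.symm h.2)]
        simp
      · exact fun s _ => if_neg fun h' => h ((mem_ends_iff v e).mpr ⟨s, h'⟩)

/-- Functions on the edges of `T` whose sum over the sides of every tile vanishes are coboundaries
of functions on the vertices. -/
theorem exists_coboundary (hT : NoOverlap T) (hT' : NoHoles T) {h : Edge → ZMod 2}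
    (hh : ∀ A ∈ T, ∑ e ∈ A.sides, h e = 0) :
    ∃ f : Vertex → ZMod 2, ∀ e ∈ edges T, h e = f e.1 + f (Edge.tip e) := by
  set p : Submodule (ZMod 2) (Edge →₀ ZMod 2) := Finsupp.supported (ZMod 2) (ZMod 2) (edges T)
  set H : (Edge →₀ ZMod 2) →ₗ[ZMod 2] ZMod 2 := Finsupp.linearCombination (ZMod 2) h
  -- A cycle on the edges of `T` is a sum of tile boundaries, and `h` sums to zero over each of
  -- these.
  have hker : ∀ z : p, bdry.domRestrict p z = 0 → H.domRestrict p z = 0 := by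
    rintro ⟨z, hzp⟩ hz
    have hz0 : bdry z = 0 := hz
    have hzE : ∀ e, e ∉ edges T → z e = 0 := fun e he => by
      rw [Finsupp.mem_supported'] at hzp
      exact hzp e (by simpa using he)
    obtain ⟨c, hc⟩ := exists_chain hT hT' hzE fun v => by rw [← bdry_apply, hz0]; rfl
    change H z = 0
    have : H z = ∑ e ∈ edges T, z e * h e := by
      rw [Finsupp.linearCombination_apply, Finsupp.sum_of_support_subset z (s := edges T)]
      · rfl
      · exact_mod_cast (Finsupp.mem_supported (ZMod 2) z).mp hzp
      · simp
    rw [this]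
    simp only [hc, Finset.sum_mul]
    rw [Finset.sum_comm]
    refine Finset.sum_eq_zero fun A hA => ?_
    have hsub : A.sides ⊆ edges T := fun e he => mem_edges.mpr ⟨A, hA, he⟩
    calc ∑ e ∈ edges T, (if e ∈ A.sides then c A else 0) * h e
        = ∑ e ∈ A.sides, c A * h e := by
          rw [← Finset.sum_subset hsub fun e _ he => by simp [he]]
          exact Finset.sum_congr rfl fun e he => by simp [he]
      _ = 0 := by rw [← Finset.mul_sum, hh A hA, mul_zero]
  obtain ⟨φ, hφ⟩ := exists_factor (F := ZMod 2) (E := p) (bdry.domRestrict p) (H.domRestrict p) hker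
  refine ⟨fun v => φ (Finsupp.single v 1), fun e he => ?_⟩
  have hep : Finsupp.single e (1 : ZMod 2) ∈ p := Finsupp.single_mem_supported _ _ he
  have := hφ ⟨_, hep⟩
  change φ (bdry (Finsupp.single e 1)) = H (Finsupp.single e 1) at this
  rw [bdry_single, map_add] at this
  rw [this]
  simp [H]

/-- Functions on the vertices of the single tiles whose coboundaries agree on common sides come from
a function on the vertices of `T`, up to constants on the single tiles. -/
theorem exists_glued (hT : NoOverlap T) (hT' : NoHoles T) (g : Tile → Vertex → ZMod 2)
    (hg : ∀ A ∈ T, ∀ B ∈ T, A ≠ B → ∀ e ∈ A.sides, e ∈ B.sides →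
      g A e.1 + g A (Edge.tip e) = g B e.1 + g B (Edge.tip e)) :
    ∃ f : Vertex → ZMod 2, ∀ A ∈ T, ∀ e ∈ A.sides,
      f e.1 + f (Edge.tip e) = g A e.1 + g A (Edge.tip e) := by
  classical
  -- The tile chosen at a common side does not matter, by `hg`.
  set h : Edge → ZMod 2 := fun e => if he : ∃ A ∈ T, e ∈ A.sides then
    g he.choose e.1 + g he.choose (Edge.tip e) else 0 with hdef
  have key : ∀ A ∈ T, ∀ e ∈ A.sides, h e = g A e.1 + g A (Edge.tip e) := by
    intro A hA e he
    have hex : ∃ A ∈ T, e ∈ A.sides := ⟨A, hA, he⟩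
    simp only [hdef, dif_pos hex]
    by_cases hne : hex.choose = A
    · rw [hne]
    · exact hg _ hex.choose_spec.1 A hA hne e hex.choose_spec.2 he
  obtain ⟨f, hf⟩ := exists_coboundary hT hT' (h := h) fun A hA => by
    rw [Finset.sum_congr rfl (key A hA)]
    exact sum_sides_eq_zero A (g A)
  exact ⟨f, fun A hA e he => by rw [← hf e (mem_edges.mpr ⟨A, hA, he⟩), key A hA e he]⟩

/-- A function that agrees at the ends of each side is constant on the corners of the tile. -/
theorem vertices_eq_of_sides {A : Tile} {f : Vertex → ZMod 2}
    (h : ∀ e ∈ A.sides, f e.1 = f (Edge.tip e)) {v w : Vertex} (hv : v ∈ A.vertices)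
    (hw : w ∈ A.vertices) : f v = f w := by
  have h1 := h (A.base, A.kind + 1) (by simp [Tile.sides])
  have h2 := h (A.base, A.kind + 2) (by simp [Tile.sides])
  have h3 := h (A.base + dir (A.kind + 1), A.kind + 2) (by simp [Tile.sides])
  simp only [Edge.tip] at h1 h2 h3
  have key : ∀ v ∈ A.vertices, f v = f A.base := by
    intro v hv
    simp only [Tile.vertices, Finset.mem_insert, Finset.mem_singleton] at hv
    rcases hv with rfl | rfl | rfl | rfl
    · rfl
    · exact h1.symm
    · exact h2.symm
    · rw [← h3, ← h1]
  rw [key v hv, key w hw]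

/-- Induction along adjacent tiles. -/
theorem walk_induction {G : SimpleGraph Tile} (hc : (G.induce (T : Set Tile)).Preconnected)
    {P : Tile → Prop} (hP : ∀ A ∈ T, ∀ B ∈ T, G.Adj A B → P A → P B) {A B : Tile} (hA : A ∈ T)
    (hB : B ∈ T) (h : P A) : P B := by
  obtain ⟨w⟩ := hc ⟨A, hA⟩ ⟨B, hB⟩
  have key : ∀ {x y : (T : Set Tile)}, (G.induce (T : Set Tile)).Walk x y → P x → P y := by
    intro x y w
    induction w with
    | nil => exact id
    | @cons x y z h _ ih => exact fun hx => ih (hP x x.2 y y.2 h hx)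
  exact key w h

/-- Modulo boundaries of edges, the two ends of an edge agree; by connectedness one vertex then
generates all of them. So the rank of the boundary map is at least the number of vertices minus one.
-/
theorem verts_sub_mem (hc : (adjGraph.induce (T : Set Tile)).Preconnected) {A₀ : Tile}
    (hA₀ : A₀ ∈ T) {Q : Submodule (ZMod 2) (Vertex →₀ ZMod 2)}
    (hQ : ∀ e ∈ edges T, Finsupp.single e.1 1 + Finsupp.single (Edge.tip e) 1 ∈ Q)
    (h0 : Finsupp.single A₀.base 1 ∈ Q) {v : Vertex} (hv : v ∈ verts T) :
    Finsupp.single v 1 ∈ Q := by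
  have hiff : ∀ e ∈ edges T, Finsupp.single e.1 (1 : ZMod 2) ∈ Q ↔
      Finsupp.single (Edge.tip e) (1 : ZMod 2) ∈ Q := fun e he =>
    ⟨fun h => (Submodule.add_mem_iff_right Q h).mp (hQ e he),
      fun h => (Submodule.add_mem_iff_left Q h).mp (hQ e he)⟩
  have hone : ∀ A ∈ T, ∀ v ∈ A.vertices, ∀ w ∈ A.vertices,
      Finsupp.single v (1 : ZMod 2) ∈ Q → Finsupp.single w (1 : ZMod 2) ∈ Q := by
    classical
    intro A hA v hv w hw h
    have := vertices_eq_of_sides (A := A)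
      (f := fun v => if Finsupp.single v (1 : ZMod 2) ∈ Q then 1 else 0) (fun e he => by
        simp only [hiff e (mem_edges.mpr ⟨A, hA, he⟩)]) hv hw
    by_contra hcon
    simp [h, hcon] at this
  have hends : ∀ e : Edge, e.1 ∈ ends e := fun e => mem_ends.mpr (Or.inl rfl)
  obtain ⟨A, hA, hvA⟩ := mem_verts.mp hv
  refine walk_induction hc (P := fun A => ∀ v ∈ A.vertices, Finsupp.single v (1 : ZMod 2) ∈ Q)
    ?_ hA₀ hA ?_ v hvA
  · rintro A hA B hB ⟨_, e, heA, heB⟩ h w hw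
    exact hone B hB e.1 (ends_subset heB (hends e)) w hw (h e.1 (ends_subset heA (hends e)))
  · exact fun w hw => hone A₀ hA₀ _ (by simp [Tile.vertices]) w hw h0

/-- Euler's inequality. -/
theorem euler (hT : NoOverlap T) (hc : (adjGraph.induce (T : Set Tile)).Preconnected)
    (hne : T.Nonempty) : (verts T).card + T.card ≤ (edges T).card + 1 := by
  obtain ⟨A₀, hA₀⟩ := hne
  set p : Submodule (ZMod 2) (Edge →₀ ZMod 2) := Finsupp.supported (ZMod 2) (ZMod 2) (edges T)
  set R := LinearMap.range (bdry.domRestrict p)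
  set Q : Submodule (ZMod 2) (Vertex →₀ ZMod 2) := R ⊔ Submodule.span (ZMod 2)
    {Finsupp.single A₀.base 1}
  have hpfin : Module.finrank (ZMod 2) p = (edges T).card := by
    rw [(Finsupp.supportedEquivFinsupp (M := ZMod 2) (R := ZMod 2) (edges T : Set Edge)).finrank_eq]
    simp
  have : Module.Finite (ZMod 2) p :=
    Module.Finite.equiv
      (Finsupp.supportedEquivFinsupp (M := ZMod 2) (R := ZMod 2) (edges T : Set Edge)).symm
  have hV : Finsupp.supported (ZMod 2) (ZMod 2) (verts T : Set Vertex) ≤ Q := by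
    rw [Finsupp.supported_eq_span_single, Submodule.span_le]
    rintro _ ⟨v, hv, rfl⟩
    refine verts_sub_mem hc hA₀ (fun e he => ?_) ?_ hv
    · refine Submodule.mem_sup_left ⟨⟨Finsupp.single e 1, ?_⟩, ?_⟩
      · exact Finsupp.single_mem_supported _ _ he
      · exact bdry_single e
    · exact Submodule.mem_sup_right (Submodule.mem_span_singleton_self _)
  have h1 : (verts T).card ≤ Module.finrank (ZMod 2) R + 1 := by
    calc (verts T).card
        = Module.finrank (ZMod 2) (Finsupp.supported (ZMod 2) (ZMod 2) (verts T : Set Vertex)) := by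
          rw [(Finsupp.supportedEquivFinsupp (M := ZMod 2) (R := ZMod 2)
            (verts T : Set Vertex)).finrank_eq]
          simp
      _ ≤ Module.finrank (ZMod 2) Q := Submodule.finrank_mono hV
      _ ≤ Module.finrank (ZMod 2) R + Module.finrank (ZMod 2)
            (Submodule.span (ZMod 2) {Finsupp.single A₀.base (1 : ZMod 2)}) :=
          Submodule.finrank_add_le_finrank_add_finrank _ _
      _ ≤ Module.finrank (ZMod 2) R + 1 := by
          gcongr
          exact (finrank_span_le_card _).trans (by simp)
  have hA : ∀ A : T, ∑ e ∈ (A : Tile).sides, Finsupp.single e (1 : ZMod 2) ∈ p := fun A =>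
    Submodule.sum_mem _ fun e he =>
      Finsupp.single_mem_supported _ _ (mem_edges.mpr ⟨A, A.2, he⟩)
  -- Tile boundaries are cycles, and independent by `boundary_injective`.
  have h2 := finrank_le_of_image (F := ZMod 2) (E := p) (ι := T) (bdry.domRestrict p)
    (Fintype.linearCombination (ZMod 2) fun A : T => (⟨_, hA A⟩ : p)) ?_ ?_
  · rw [hpfin, Fintype.card_coe] at h2
    change Module.finrank (ZMod 2) R + _ ≤ _ at h2
    omega
  · rw [injective_iff_map_eq_zero]
    intro c h
    set c' : Tile → ZMod 2 := fun A => if hA : A ∈ T then c ⟨A, hA⟩ else 0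
    have hval : ∀ A : T, c' A = c A := fun A => by simp [c']
    have := boundary_injective hT c' fun e => by
      have h' := DFunLike.congr_fun (congrArg Subtype.val h) e
      rw [Fintype.linearCombination_apply] at h'
      simp only [Submodule.coe_sum, Submodule.coe_smul, Finsupp.coe_finsetSum, Finset.sum_apply,
        Finsupp.smul_apply, Finsupp.single_apply, ZeroMemClass.coe_zero, Finsupp.coe_zero,
        Pi.zero_apply, Finset.sum_ite_eq', smul_eq_mul, mul_ite, mul_one, mul_zero] at h'
      refine Eq.trans ?_ h'
      rw [← Finset.sum_coe_sort T]
      exact Finset.sum_congr rfl fun A _ => by rw [hval]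
    funext A
    rw [← hval]
    exact this A A.2
  · intro c
    rw [Fintype.linearCombination_apply, map_sum]
    refine Finset.sum_eq_zero fun A _ => ?_
    rw [map_smul]
    convert smul_zero (c A)
    change bdry (∑ e ∈ (A : Tile).sides, Finsupp.single e (1 : ZMod 2)) = 0
    ext v
    rw [map_sum, Finsupp.finsetSum_apply]
    simp only [bdry_single, Finsupp.add_apply]
    exact sum_sides_eq_zero A fun w => Finsupp.single w (1 : ZMod 2) v

end Cohomology

variable {κ : ℕ} {T : Finset Tile}

/-! ### Sides of tiles -/

/-- The edge in direction `j` of the triangle of type `true` of `A`. -/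
def Tile.uside (A : Tile) (j : Fin 3) : Edge := (A.up.1 + upOff j, j)

/-- The edge in direction `j` of the triangle of type `false` of `A`. -/
def Tile.dside (A : Tile) (j : Fin 3) : Edge := (A.dn.1 + dnOff j, j)

theorem upTri_uside (A : Tile) (j : Fin 3) : upTri (A.uside j) = A.up := by
  simp [upTri, Tile.uside, Tile.up]

theorem dnTri_dside (A : Tile) (j : Fin 3) : dnTri (A.dside j) = A.dn := by
  simp [dnTri, Tile.dside, Tile.dn]

theorem eq_uside {A : Tile} {e : Edge} (h : upTri e = A.up) : e = A.uside e.2 :=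
  edge_ext_up (h.trans (upTri_uside A _).symm) rfl

theorem eq_dside {A : Tile} {e : Edge} (h : dnTri e = A.dn) : e = A.dside e.2 :=
  edge_ext_dn (h.trans (dnTri_dside A _).symm) rfl

theorem mem_sides_iff_uside (A : Tile) (e : Edge) :
    e ∈ A.sides ↔ e.2 ≠ A.kind ∧ (e = A.uside e.2 ∨ e = A.dside e.2) := by
  rw [mem_sides_iff]
  refine and_congr Iff.rfl (or_congr ⟨eq_uside, fun h => ?_⟩ ⟨eq_dside, fun h => ?_⟩)
  · rw [h, upTri_uside]
  · rw [h, dnTri_dside]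

theorem uside_mem {A : Tile} {j : Fin 3} (h : j ≠ A.kind) : A.uside j ∈ A.sides :=
  (mem_sides_iff_uside A _).mpr ⟨h, Or.inl rfl⟩

theorem dside_mem {A : Tile} {j : Fin 3} (h : j ≠ A.kind) : A.dside j ∈ A.sides :=
  (mem_sides_iff_uside A _).mpr ⟨h, Or.inr rfl⟩

theorem covers_up (A : Tile) : A.Covers A.up := (covers_iff A _).mpr (Or.inl rfl)

theorem covers_dn (A : Tile) : A.Covers A.dn := (covers_iff A _).mpr (Or.inr rfl)

theorem uside_ne_dside {A : Tile} {i j : Fin 3} (hi : i ≠ A.kind) : A.uside i ≠ A.dside j := by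
  intro h
  have h1 := upTri_uside A i
  have h2 := dnTri_dside A j
  rw [← h] at h2
  have := edge_ext (e' := A.diag) h1 h2
  exact hi (congrArg Prod.snd this)

theorem dside_ends {A : Tile} {i : Fin 3} (hi : i ≠ A.kind) {v : Vertex}
    (hv : v ∈ ends (A.dside i)) : v ∉ ends (A.uside i) := by
  obtain ⟨⟨a, b⟩, k⟩ := A
  obtain ⟨x, y⟩ := v
  fin_cases k <;> fin_cases i <;> simp [Tile.uside, Tile.dside, Tile.up, Tile.dn, Tile.diag, upTri,
    dnTri, upOff, dnOff, dir, ends] at hi hv ⊢ <;> omega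

theorem uside_cross {A : Tile} {i j : Fin 3} (hi : i ≠ A.kind) (hj : j ≠ A.kind) (hij : i ≠ j) :
    (((A.uside j).1 ∈ ends (A.uside i) ∧ Edge.tip (A.uside j) ∈ ends (A.dside i)) ∨
      ((A.uside j).1 ∈ ends (A.dside i) ∧ Edge.tip (A.uside j) ∈ ends (A.uside i))) := by
  obtain ⟨⟨a, b⟩, k⟩ := A
  fin_cases k <;> fin_cases i <;> fin_cases j <;> simp [Tile.uside, Tile.dside, Tile.up, Tile.dn,
    Tile.diag, upTri, dnTri, upOff, dnOff, dir, ends, Edge.tip] at hi hj hij ⊢ <;> omega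

/-- A side of a tile of `T` is a side of another tile of `T` iff both its triangles are covered. -/
theorem exists_across (hT : NoOverlap T) {A : Tile} (hA : A ∈ T) {e : Edge} (he : e ∈ A.sides)
    (h1 : Cov T (upTri e)) (h2 : Cov T (dnTri e)) : ∃ B ∈ T, B ≠ A ∧ e ∈ B.sides := by
  rcases (mem_sides_iff_xor A e).mp he with ⟨h, h'⟩ | ⟨h, h'⟩
  · obtain ⟨B, hB, hBc⟩ := h2
    have hne : B ≠ A := fun h => h' (h ▸ hBc)
    exact ⟨B, hB, hne, (mem_sides_iff_xor B e).mpr (Or.inr ⟨hBc, fun hh => hne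
      (hT.unique hB hA hh h)⟩)⟩
  · obtain ⟨B, hB, hBc⟩ := h1
    have hne : B ≠ A := fun h => h' (h ▸ hBc)
    exact ⟨B, hB, hne, (mem_sides_iff_xor B e).mpr (Or.inl ⟨hBc, fun hh => hne
      (hT.unique hB hA hh h)⟩)⟩

theorem cov_of_shared (hT : NoOverlap T) {A B : Tile} (hA : A ∈ T) (hB : B ∈ T) (hne : A ≠ B)
    {e : Edge} (heA : e ∈ A.sides) (heB : e ∈ B.sides) :
    Cov T (upTri e) ∧ Cov T (dnTri e) := by
  rcases (mem_sides_iff_xor A e).mp heA with ⟨h, h'⟩ | ⟨h, h'⟩ <;>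
    rcases (mem_sides_iff_xor B e).mp heB with ⟨k, k'⟩ | ⟨k, k'⟩
  · exact absurd (hT.unique hA hB h k) hne
  · exact ⟨⟨A, hA, h⟩, ⟨B, hB, k⟩⟩
  · exact ⟨⟨B, hB, k⟩, ⟨A, hA, h⟩⟩
  · exact absurd (hT.unique hA hB h k) hne

/-- No tile has its two sides in one direction shared and those in the other direction free: the
removal of such a tile would disconnect a tiling without holes. -/
theorem not_middle (hT : IsDokuTiling κ T) {A : Tile} (hA : A ∈ T) {i j : Fin 3}
    (hi : i ≠ A.kind) (hj : j ≠ A.kind) (hij : i ≠ j)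
    (h1 : Cov T (dnTri (A.uside i))) (h2 : Cov T (upTri (A.dside i)))
    (h3 : ¬ Cov T (dnTri (A.uside j))) (h4 : ¬ Cov T (upTri (A.dside j))) : False := by
  have hO : NoOverlap T := hT.no_overlap
  have third : ∀ a b c k : Fin 3, a ≠ k → b ≠ k → a ≠ b → c ≠ k → c = a ∨ c = b := by decide
  -- The indicator, on `A` alone, of one of its two shared sides. It is constant along both shared
  -- sides, hence compatible with 0 on the other tiles. The glued `f` is constant on every tile
  -- except `A`, but jumps along the free sides of `A`.
  set g : Tile → Vertex → ZMod 2 := fun B v =>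
    if B = A ∧ v ∈ ends (A.uside i) then 1 else 0 with hg
  have hgB : ∀ B, B ≠ A → ∀ v, g B v = 0 := fun B hB v => if_neg fun h => hB h.1
  have hgu : ∀ v ∈ ends (A.uside i), g A v = 1 := fun v hv => if_pos ⟨rfl, hv⟩
  have hgd : ∀ v ∈ ends (A.dside i), g A v = 0 := fun v hv => if_neg fun h =>
    dside_ends hi hv h.2
  have hbase : ∀ e : Edge, e.1 ∈ ends e := fun e => mem_ends.mpr (Or.inl rfl)
  have htip : ∀ e : Edge, Edge.tip e ∈ ends e := fun e => mem_ends.mpr (Or.inr rfl)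
  have hA0 : ∀ B ∈ T, B ≠ A → ∀ e ∈ A.sides, e ∈ B.sides → g A e.1 + g A (Edge.tip e) = 0 := by
    intro B hB hne e heA heB
    obtain ⟨c1, c2⟩ := cov_of_shared hO hA hB hne.symm heA heB
    obtain ⟨hk, he⟩ := (mem_sides_iff_uside A e).mp heA
    rcases third i j e.2 A.kind hi hj hij hk with h | h <;> rw [h] at he
    · rcases he with he | he <;> rw [he]
      · rw [hgu _ (hbase _), hgu _ (htip _)]; rfl
      · rw [hgd _ (hbase _), hgd _ (htip _)]; rfl
    · rcases he with he | he <;> rw [he] at c1 c2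
      · exact absurd c2 h3
      · exact absurd c1 h4
  obtain ⟨f, hf⟩ := exists_glued hO hT.no_holes g fun B hB C hC hne e heB heC => by
    by_cases hBA : B = A
    · subst hBA
      rw [hA0 C hC hne.symm e heB heC, hgB C hne.symm, hgB C hne.symm, add_zero]
    · rw [hgB B hBA, hgB B hBA]
      by_cases hCA : C = A
      · subst hCA
        rw [hA0 B hB hne e heC heB, add_zero]
      · rw [hgB C hCA, hgB C hCA]
  have hconst : ∀ B ∈ T, B ≠ A → ∀ v ∈ B.vertices, ∀ w ∈ B.vertices, f v = f w := by
    intro B hB hne v hv w hw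
    refine vertices_eq_of_sides (fun e he => ?_) hv hw
    have := hf B hB e he
    rw [hgB B hne, hgB B hne, add_zero] at this
    exact CharTwo.add_eq_zero.mp this
  obtain ⟨B, hB, hBA, hBe⟩ := exists_across hO hA (uside_mem hi)
    ⟨A, hA, by rw [upTri_uside]; exact covers_up A⟩ h1
  obtain ⟨C, hC, hCA, hCe⟩ := exists_across hO hA (dside_mem hi) h2
    ⟨A, hA, by rw [dnTri_dside]; exact covers_dn A⟩
  -- The tiles across the two shared sides stay connected by vertices when `A` is removed, so `f`
  -- agrees on them; this contradicts the jump.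
  have hBC : ∀ v ∈ B.vertices, ∀ w ∈ C.vertices, f v = f w := by
    intro v hv
    refine walk_induction (hT.two_connected A hA)
      (P := fun C => ∀ w ∈ C.vertices, f v = f w) ?_ (Finset.mem_erase.mpr ⟨hBA, hB⟩)
      (Finset.mem_erase.mpr ⟨hCA, hC⟩) (hconst B hB hBA v hv)
    rintro D - D' hD' ⟨-, x, hxD, hxD'⟩ h w hw
    obtain ⟨hne', hD'⟩ := Finset.mem_erase.mp hD'
    rw [h x hxD, hconst D' hD' hne' x hxD' w hw]
  have hfin : ∀ v ∈ ends (A.uside i), ∀ w ∈ ends (A.dside i), f v + f w = 0 := fun v hv w hw => by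
    rw [hBC v (ends_subset hBe hv) w (ends_subset hCe hw), CharTwo.add_self_eq_zero]
  have hu := hf A hA (A.uside j) (uside_mem hj)
  rcases uside_cross hi hj hij with ⟨c1, c2⟩ | ⟨c1, c2⟩
  · rw [hfin _ c1 _ c2, hgu _ c1, hgd _ c2] at hu
    simp at hu
  · rw [add_comm (f _), hfin _ c2 _ c1, hgu _ c2, hgd _ c1] at hu
    simp at hu

/-! ### The tiles at a vertex -/

theorem mem_ends_of_mem {v : Vertex} {e : Edge} (h1 : v ∈ Triangle.vertices (upTri e))
    (h2 : v ∈ Triangle.vertices (dnTri e)) : v ∈ ends e := by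
  obtain ⟨⟨a, b⟩, j⟩ := e
  obtain ⟨x, y⟩ := v
  fin_cases j <;> simp [Triangle.vertices, upTri, dnTri, upOff, dnOff, dir, ends] at h1 h2 ⊢ <;>
    omega

/-- The two triangles of a tile are neighbours in the cyclic order around each of their common
corners. -/
theorem covers_two {A : Tile} {v : Vertex} {r r' : ZMod 6} (h : A.Covers (tri v r))
    (h' : A.Covers (tri v r')) : r' = r ∨ r' = r + 1 ∨ r = r' + 1 := by
  have aux : ∀ r r' : ZMod 6, tri v r = A.up → tri v r' = A.dn → r' = r + 1 ∨ r = r' + 1 := by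
    intro r r' h h'
    have h1 := mem_tri v r
    have h2 := mem_tri v r'
    rw [h] at h1
    rw [h'] at h2
    obtain ⟨s, hs⟩ := (mem_ends_iff v _).mp (mem_ends_of_mem (e := A.diag) h1 h2)
    rw [← diag_up, hs] at h
    rw [← diag_dn, hs] at h'
    rcases edgeAt_tri v s with ⟨e1, e2⟩ | ⟨e1, e2⟩ <;> rw [e1] at h <;> rw [e2] at h' <;>
      have h := tri_injective v h <;> have h' := tri_injective v h' <;> subst h <;> subst h' <;>
      simp
  rcases (covers_iff A _).mp h with h | h <;> rcases (covers_iff A _).mp h' with h' | h'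
  · exact Or.inl (tri_injective v (h'.trans h.symm))
  · exact Or.inr (aux r r' h h')
  · exact Or.inr (aux r' r h' h).symm
  · exact Or.inl (tri_injective v (h'.trans h.symm))

/-- A label that changes only next to uncovered triangles cannot take two values, since tiles
meeting in two separate blocks at `v` would enclose a hole. Give every tile its label at the corner
`v` and 0 at the other corners, and glue to `f`. On each tile the sum of `f` and its function is
constant, and adjacent tiles have the same constant because they share a vertex other than `v`.
Comparing at `v` gives equal labels. -/
theorem no_pinch (hT : IsDokuTiling κ T) (v : Vertex) (β : ZMod 6 → ZMod 2)
    (hβ : ∀ r, Cov T (tri v r) → Cov T (tri v (r + 1)) → β r = β (r + 1)) {r r' : ZMod 6}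
    (hr : Cov T (tri v r)) (hr' : Cov T (tri v r')) : β r = β r' := by
  classical
  have hO : NoOverlap T := hT.no_overlap
  set bT : Tile → ZMod 2 := fun A => if h : ∃ s, A.Covers (tri v s) then β h.choose else 0 with hbT
  have hb : ∀ A ∈ T, ∀ s, A.Covers (tri v s) → bT A = β s := by
    intro A hA s hs
    have hex : ∃ s, A.Covers (tri v s) := ⟨s, hs⟩
    have hc := hex.choose_spec
    simp only [hbT, dif_pos hex]
    rcases covers_two hs hc with h | h | h
    · rw [h]
    · rw [h]
      exact (hβ s ⟨A, hA, hs⟩ ⟨A, hA, h ▸ hc⟩).symm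
    · refine Eq.trans ?_ (congrArg β h.symm)
      exact hβ _ ⟨A, hA, hc⟩ ⟨A, hA, by rwa [← h]⟩
  set g : Tile → Vertex → ZMod 2 := fun A u => if u = v then bT A else 0 with hg
  have hshare : ∀ A ∈ T, ∀ B ∈ T, A ≠ B → ∀ e ∈ A.sides, e ∈ B.sides → v ∈ ends e →
      bT A = bT B := by
    intro A hA B hB hne e heA heB hv
    obtain ⟨s, rfl⟩ := (mem_ends_iff v e).mp hv
    have hs : s - 1 + 1 = s := by ring
    have hh : Cov T (tri v s) → Cov T (tri v (s - 1)) → β (s - 1) = β s := fun h1 h2 => by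
      have := hβ (s - 1) h2 (by rwa [hs])
      rwa [hs] at this
    rcases ((mem_sides_edgeAt A v s).mp heA).2 with hA1 | hA1 <;>
      rcases ((mem_sides_edgeAt B v s).mp heB).2 with hB1 | hB1
    · exact absurd (hO.unique hA hB hA1 hB1) hne
    · rw [hb A hA _ hA1, hb B hB _ hB1, hh ⟨A, hA, hA1⟩ ⟨B, hB, hB1⟩]
    · rw [hb A hA _ hA1, hb B hB _ hB1, hh ⟨B, hB, hB1⟩ ⟨A, hA, hA1⟩]
    · exact absurd (hO.unique hA hB hA1 hB1) hne
  obtain ⟨f, hf⟩ := exists_glued hO hT.no_holes g fun A hA B hB hne e heA heB => by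
    by_cases hv : v ∈ ends e
    · simp only [hg, hshare A hA B hB hne e heA heB hv]
    · rw [mem_ends, not_or] at hv
      simp only [hg, if_neg (Ne.symm hv.1), if_neg (Ne.symm hv.2)]
  have hconst : ∀ A ∈ T, ∀ x ∈ A.vertices, ∀ y ∈ A.vertices, f x + g A x = f y + g A y := by
    intro A hA x hx y hy
    refine vertices_eq_of_sides (f := fun x => f x + g A x) (fun e he => ?_) hx hy
    have := hf A hA e he
    have two : (2 : ZMod 2) = 0 := rfl
    linear_combination this + (g A e.1 - f (Edge.tip e)) * two
  obtain ⟨A, hA, hAr⟩ := hr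
  obtain ⟨B, hB, hBr⟩ := hr'
  have hvA : v ∈ A.vertices := (mem_vertices_iff_tri A v).mpr ⟨r, hAr⟩
  have hvB : v ∈ B.vertices := (mem_vertices_iff_tri B v).mpr ⟨r', hBr⟩
  have := walk_induction hT.edge_connected.preconnected
    (P := fun B => ∀ w ∈ B.vertices, f v + g A v = f w + g B w) ?_ hA hB (hconst A hA v hvA) v hvB
  · rw [← hb A hA r hAr, ← hb B hB r' hBr]
    simpa [hg] using this
  · rintro C hC D hD ⟨hne, e, heC, heD⟩ h w hw
    have : ∃ u ∈ ends e, u ≠ v := by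
      by_cases hv : e.1 = v
      · exact ⟨Edge.tip e, mem_ends.mpr (Or.inr rfl), fun h' => Edge.tip_ne e (hv.trans h'.symm)⟩
      · exact ⟨e.1, mem_ends.mpr (Or.inl rfl), hv⟩
    obtain ⟨u, hu, huv⟩ := this
    rw [h u (ends_subset heC hu), hconst D hD w hw u (ends_subset heD hu)]
    simp only [hg, if_neg huv]

/-- The covered triangles at a vertex form one block in the cyclic order. -/
theorem transition_unique (hT : IsDokuTiling κ T) {v : Vertex} {s s' : ZMod 6}
    (h1 : ¬ Cov T (tri v s)) (h2 : Cov T (tri v (s + 1))) (h1' : ¬ Cov T (tri v s'))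
    (h2' : Cov T (tri v (s' + 1))) : s = s' := by
  by_contra hne
  -- The label is membership in the arc from `s + 1` to `s'`; it changes only just after the
  -- uncovered positions `s` and `s'`.
  have key : ∀ s s' : ZMod 6, s ≠ s' → (∀ r, ((r - s - 1).val < (s' - s).val ↔
      (r + 1 - s - 1).val < (s' - s).val) ∨ r = s ∨ r = s') ∧
      (s + 1 - s - 1).val < (s' - s).val ∧ ¬ (s' + 1 - s - 1).val < (s' - s).val := by decide
  obtain ⟨k1, k2, k3⟩ := key s s' hne
  have := no_pinch hT v (fun r => if (r - s - 1).val < (s' - s).val then 1 else 0)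
    (fun r hr hr' => by
      rcases k1 r with h | rfl | rfl
      · simp only [h]
      · exact absurd hr h1
      · exact absurd hr h1') h2 h2'
  simp only [k2, k3] at this
  simp at this

/-- A tile whose two sides at a vertex are free is the only tile at this vertex. -/
theorem eq_of_free (hT : IsDokuTiling κ T) {A : Tile} (hA : A ∈ T) {v : Vertex}
    (hv : v ∈ A.vertices)
    (h : ∀ s, edgeAt v s ∈ A.sides → ¬ (Cov T (tri v s) ∧ Cov T (tri v (s - 1)))) {r : ZMod 6}
    (hr : Cov T (tri v r)) : A.Covers (tri v r) := by
  obtain ⟨r₀, hr₀⟩ := (mem_vertices_iff_tri A v).mp hv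
  have := no_pinch hT v (fun r => if A.Covers (tri v r) then 1 else 0) ?_ ⟨A, hA, hr₀⟩ hr
  · by_contra hcon
    simp [hr₀, hcon] at this
  · intro s h1 h2
    have hs := h (s + 1)
    rw [mem_sides_iff_xor, add_sub_cancel_right] at hs
    by_cases c1 : A.Covers (tri v s) <;> by_cases c2 : A.Covers (tri v (s + 1)) <;>
      simp only [c1, c2]
    all_goals
      exfalso
      refine hs ?_ ⟨h2, h1⟩
      rcases edgeAt_tri v (s + 1) with ⟨e1, e2⟩ | ⟨e1, e2⟩ <;>
        rw [e1, e2, add_sub_cancel_right] <;> simp [Xor, c1, c2]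

/-! ### Disjoint unions of paths -/

section Paths

variable {α : Type*} {G : SimpleGraph α} {R : α → α → Prop}

/-- Predecessors are unique, so a backward step from a vertex reached from the source `a` only
retraces the last forward step. -/
theorem reflTransGen_of_start (hG : ∀ a b, G.Adj a b ↔ R a b ∨ R b a)
    (hinj : ∀ a a' b, R a b → R a' b → a = a') {a b : α} (ha : ∀ x, ¬ R x a)
    (h : G.Reachable a b) : Relation.ReflTransGen R a b := by
  obtain ⟨w⟩ := h.symm
  induction w with
  | nil => exact Relation.ReflTransGen.refl
  | @cons x y _ hxy w ih =>
    have hay := ih ha ⟨w.reverse⟩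
    rcases (hG x y).mp hxy with h | h
    · rcases Relation.ReflTransGen.cases_tail hay with h' | ⟨z, hz, hzy⟩
      · exact absurd (h' ▸ h) (ha x)
      · rwa [hinj x z y h hzy]
    · exact hay.tail h

theorem start_unique (hG : ∀ a b, G.Adj a b ↔ R a b ∨ R b a)
    (hinj : ∀ a a' b, R a b → R a' b → a = a') {a b : α} (ha : ∀ x, ¬ R x a) (hb : ∀ x, ¬ R x b)
    (h : G.Reachable a b) : a = b := by
  rcases Relation.ReflTransGen.cases_tail (reflTransGen_of_start hG hinj ha h) with h | ⟨z, -, hz⟩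
  · exact h.symm
  · exact absurd hz (hb z)

theorem exists_start [Finite α] (hG : ∀ a b, G.Adj a b ↔ R a b ∨ R b a) {l : α → ℤ}
    (hl : ∀ a b, R a b → l a < l b) (c : G.ConnectedComponent) :
    ∃ a, G.connectedComponentMk a = c ∧ ∀ x, ¬ R x a := by
  obtain ⟨a, ha, hmin⟩ := c.supp.toFinite.exists_minimalFor l c.supp c.nonempty_supp
  refine ⟨a, ha, fun x hx => ?_⟩
  have hxa : G.Adj x a := (hG x a).mpr (Or.inl hx)
  have hxc : x ∈ c.supp := by
    rw [SimpleGraph.ConnectedComponent.mem_supp_iff] at ha ⊢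
    rw [← ha]
    exact SimpleGraph.ConnectedComponent.sound hxa.reachable
  have := hmin hxc (hl x a hx).le
  exact absurd (hl x a hx) (not_lt.mpr this)

theorem nontrivial_iff_exists_adj (a : α) :
    (G.connectedComponentMk a).supp.Nontrivial ↔ ∃ b, G.Adj a b := by
  constructor
  · intro h
    obtain ⟨b, hb, hne⟩ := h.exists_ne a
    obtain ⟨w⟩ := (SimpleGraph.ConnectedComponent.exact hb).symm
    cases w with
    | nil => exact absurd rfl hne
    | cons h _ => exact ⟨_, h⟩
  · rintro ⟨b, h⟩
    exact ⟨a, rfl, b, SimpleGraph.ConnectedComponent.sound h.reachable.symm, h.ne⟩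

/-- In a disjoint union of directed paths, the paths with at least two vertices correspond to their
first vertices. -/
theorem card_components [Finite α] (hG : ∀ a b, G.Adj a b ↔ R a b ∨ R b a)
    (hinj : ∀ a a' b, R a b → R a' b → a = a') {l : α → ℤ} (hl : ∀ a b, R a b → l a < l b) :
    Nat.card {c : G.ConnectedComponent // c.supp.Nontrivial} =
      Nat.card {a : α // (∀ x, ¬ R x a) ∧ ∃ x, R a x} := by
  symm
  refine Nat.card_congr (Equiv.ofBijective
    (fun a => ⟨G.connectedComponentMk a.1, (nontrivial_iff_exists_adj a.1).mpr
      (a.2.2.imp fun x hx => (hG _ _).mpr (Or.inl hx))⟩) ⟨?_, ?_⟩)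
  · rintro ⟨a, ha, _⟩ ⟨b, hb, _⟩ h
    exact Subtype.ext (start_unique hG hinj ha hb
      (SimpleGraph.ConnectedComponent.exact (congrArg Subtype.val h)))
  · rintro ⟨c, hc⟩
    obtain ⟨a, rfl, ha⟩ := exists_start hG hl c
    obtain ⟨b, hb⟩ := (nontrivial_iff_exists_adj a).mp hc
    refine ⟨⟨a, ha, b, ((hG a b).mp hb).resolve_right (ha b)⟩, rfl⟩

theorem card_nonisolated [Finite α] {k : ℕ}
    (hk : ∀ c : G.ConnectedComponent, c.supp.Nontrivial → c.supp.ncard = k) :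
    Nat.card {a : α // ∃ b, G.Adj a b} =
      k * Nat.card {c : G.ConnectedComponent // c.supp.Nontrivial} := by
  have := Fintype.ofFinite {c : G.ConnectedComponent // c.supp.Nontrivial}
  have e : {a : α // ∃ b, G.Adj a b} ≃
      Σ c : {c : G.ConnectedComponent // c.supp.Nontrivial}, c.1.supp :=
    { toFun := fun a => ⟨⟨G.connectedComponentMk a.1, (nontrivial_iff_exists_adj a.1).mpr a.2⟩,
        ⟨a.1, rfl⟩⟩
      invFun := fun x => ⟨x.2.1, (nontrivial_iff_exists_adj x.2.1).mp (by
        have := x.2.2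
        rw [SimpleGraph.ConnectedComponent.mem_supp_iff] at this
        rw [this]; exact x.1.2)⟩
      left_inv := fun a => rfl
      right_inv := by
        rintro ⟨⟨c, hc⟩, ⟨a, ha⟩⟩
        exact Sigma.subtype_ext (Subtype.ext ha) rfl }
  rw [Nat.card_congr e, Nat.card_sigma, Nat.card_eq_fintype_card, mul_comm, ← smul_eq_mul,
    ← Finset.card_univ, ← Finset.sum_const]
  exact Finset.sum_congr rfl fun c _ => hk c.1 c.2

end Paths

/-! ### Runs -/

/-- `B` follows `A` in direction `j`. -/
def Follows (j : Fin 3) (A B : Tile) : Prop :=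
  j ≠ A.kind ∧ j ≠ B.kind ∧ A.uside j = B.dside j

/-- A function that increases along the chains of direction `j`. -/
def level (j : Fin 3) (A : Tile) : ℤ :=
  (![-A.up.1.2, A.up.1.1, A.up.1.2 - A.up.1.1] : Fin 3 → ℤ) j

theorem Follows.level_lt {j : Fin 3} {A B : Tile} (h : Follows j A B) : level j A < level j B := by
  obtain ⟨h1, h2, h3⟩ := h
  obtain ⟨⟨a, b⟩, k⟩ := A
  obtain ⟨⟨x, y⟩, k'⟩ := B
  fin_cases j <;> fin_cases k <;> fin_cases k' <;>
    simp [level, Tile.uside, Tile.dside, Tile.up, Tile.dn, Tile.diag, upTri, dnTri, upOff,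
      dnOff, dir] at h1 h2 h3 ⊢ <;> omega

theorem stripGraph_adj (hT : NoOverlap T) {A B : Tile} (hA : A ∈ T) (hB : B ∈ T) (j : Fin 3) :
    (stripGraph j).Adj A B ↔ Follows j A B ∨ Follows j B A := by
  constructor
  · rintro ⟨hne, e, heA, heB, rfl⟩
    obtain ⟨hA1, hA2⟩ := (mem_sides_iff_uside A e).mp heA
    obtain ⟨hB1, hB2⟩ := (mem_sides_iff_uside B e).mp heB
    rcases hA2 with hA2 | hA2 <;> rcases hB2 with hB2 | hB2
    · refine absurd (hT.unique hA hB (t := upTri e) ?_ ?_) hne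
      · rw [hA2, upTri_uside]; exact covers_up A
      · rw [hB2, upTri_uside]; exact covers_up B
    · exact Or.inl ⟨hA1, hB1, hA2.symm.trans hB2⟩
    · exact Or.inr ⟨hB1, hA1, hB2.symm.trans hA2⟩
    · refine absurd (hT.unique hA hB (t := dnTri e) ?_ ?_) hne
      · rw [hA2, dnTri_dside]; exact covers_dn A
      · rw [hB2, dnTri_dside]; exact covers_dn B
  · have key : ∀ A B, Follows j A B → (stripGraph j).Adj A B := by
      intro A B h
      refine ⟨fun hAB => ?_, A.uside j, uside_mem h.1, ?_, rfl⟩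
      · subst hAB
        exact lt_irrefl _ h.level_lt
      · rw [h.2.2]
        exact dside_mem h.2.1
    rintro (h | h)
    exacts [key A B h, (key B A h).symm]

/-- Makes the ends of runs local: whether a chain continues is read off from the triangle across the
side. -/
theorem exists_follows_iff (hT : NoOverlap T) {A : Tile} (hA : A ∈ T) (j : Fin 3) :
    (∃ B ∈ T, Follows j A B) ↔ j ≠ A.kind ∧ Cov T (dnTri (A.uside j)) := by
  constructor
  · rintro ⟨B, hB, h1, h2, h3⟩
    refine ⟨h1, B, hB, ?_⟩
    rw [h3, dnTri_dside]; exact covers_dn B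
  · rintro ⟨h1, h2⟩
    obtain ⟨B, hB, hne, he⟩ := exists_across hT hA (uside_mem h1)
      ⟨A, hA, by rw [upTri_uside]; exact covers_up A⟩ h2
    refine ⟨B, hB, ?_⟩
    rcases (stripGraph_adj hT hA hB j).mp ⟨hne.symm, A.uside j, uside_mem h1, he, rfl⟩ with h | h
    · exact h
    · exfalso
      have h3 := h.2.2
      obtain ⟨-, h4 | h4⟩ := (mem_sides_iff_uside B _).mp he
      · refine hne (hT.unique hB hA (t := A.up) ?_ (covers_up A))
        rw [← upTri_uside A j, h4, upTri_uside]; exact covers_up B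
      · have := h.level_lt
        have h5 : Follows j A B := ⟨h1, h.1, h4⟩
        exact lt_asymm this h5.level_lt

theorem exists_follows_iff' (hT : NoOverlap T) {A : Tile} (hA : A ∈ T) (j : Fin 3) :
    (∃ B ∈ T, Follows j B A) ↔ j ≠ A.kind ∧ Cov T (upTri (A.dside j)) := by
  constructor
  · rintro ⟨B, hB, h1, h2, h3⟩
    refine ⟨h2, B, hB, ?_⟩
    rw [← h3, upTri_uside]; exact covers_up B
  · rintro ⟨h1, h2⟩
    obtain ⟨B, hB, hne, he⟩ := exists_across hT hA (dside_mem h1) h2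
      ⟨A, hA, by rw [dnTri_dside]; exact covers_dn A⟩
    refine ⟨B, hB, ?_⟩
    rcases (stripGraph_adj hT hA hB j).mp ⟨hne.symm, A.dside j, dside_mem h1, he, rfl⟩ with h | h
    · exfalso
      have h3 := h.2.2
      obtain ⟨-, h4 | h4⟩ := (mem_sides_iff_uside B _).mp he
      · have h5 : Follows j B A := ⟨h.2.1, h1, h4.symm⟩
        exact lt_asymm h.level_lt h5.level_lt
      · refine hne (hT.unique hB hA (t := A.dn) ?_ (covers_dn A))
        rw [← dnTri_dside A j, h4, dnTri_dside]; exact covers_dn B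
    · exact h

theorem Follows.left_unique (hT : NoOverlap T) {j : Fin 3} {A A' B : Tile} (hA : A ∈ T)
    (hA' : A' ∈ T) (h : Follows j A B) (h' : Follows j A' B) : A = A' := by
  refine hT.unique hA hA' (t := A.up) (covers_up A) ?_
  rw [← upTri_uside A j, h.2.2, ← h'.2.2, upTri_uside]; exact covers_up A'

theorem Follows.right_unique (hT : NoOverlap T) {j : Fin 3} {A B B' : Tile} (hB : B ∈ T)
    (hB' : B' ∈ T) (h : Follows j A B) (h' : Follows j A B') : B = B' := by
  refine hT.unique hB hB' (t := B.dn) (covers_dn B) ?_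
  rw [← dnTri_dside B j, ← h.2.2, h'.2.2, dnTri_dside]; exact covers_dn B'

/-- The pairs of a tile and one of the two directions of its sides. -/
def flags (T : Finset Tile) : Finset (Tile × Fin 3) :=
  {x ∈ T ×ˢ Finset.univ | x.2 ≠ x.1.kind}

/-- The side of type `uside` of a flag is shared. -/
abbrev Ush (T : Finset Tile) (x : Tile × Fin 3) : Prop := Cov T (dnTri (x.1.uside x.2))

/-- The side of type `dside` of a flag is shared. -/
abbrev Dsh (T : Finset Tile) (x : Tile × Fin 3) : Prop := Cov T (upTri (x.1.dside x.2))

theorem mem_flags {T : Finset Tile} {x : Tile × Fin 3} : x ∈ flags T ↔ x.1 ∈ T ∧ x.2 ≠ x.1.kind := by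
  simp [flags]

theorem card_flags_filter (T : Finset Tile) (P : Tile × Fin 3 → Prop) [DecidablePred P] :
    ((flags T).filter P).card = ∑ j, Nat.card {A : (T : Set Tile) // j ≠ A.1.kind ∧ P (A.1, j)} := by
  rw [Finset.card_eq_sum_card_fiberwise (f := Prod.snd) (t := Finset.univ) (by simp)]
  refine Finset.sum_congr rfl fun j _ => ?_
  rw [← Fintype.card_coe, ← Nat.card_eq_fintype_card]
  refine Nat.card_congr
    { toFun := fun x => ⟨⟨x.1.1, ?_⟩, ?_⟩
      invFun := fun A => ⟨(A.1.1, j), ?_⟩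
      left_inv := ?_
      right_inv := fun A => rfl }
  · have := x.2
    simp only [Finset.mem_filter, mem_flags] at this
    exact this.1.1.1
  · obtain ⟨⟨A, i⟩, hx⟩ := x
    simp only [Finset.mem_filter, mem_flags] at hx
    obtain ⟨⟨⟨-, h1⟩, h2⟩, rfl⟩ := hx
    exact ⟨h1, h2⟩
  · simp only [Finset.mem_filter, mem_flags]
    exact ⟨⟨⟨A.1.2, A.2.1⟩, A.2.2⟩, trivial⟩
  · rintro ⟨⟨A, i⟩, hx⟩
    simp only [Finset.mem_filter] at hx
    obtain ⟨-, rfl⟩ := hx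
    rfl

theorem card_flags (T : Finset Tile) : (flags T).card = 2 * T.card := by
  rw [Finset.card_eq_sum_card_fiberwise (f := Prod.fst) (t := T)
    (fun x hx => (mem_flags.mp hx).1), mul_comm, ← smul_eq_mul, ← Finset.sum_const]
  refine Finset.sum_congr rfl fun A hA => ?_
  have : (flags T).filter (fun x => x.1 = A) =
      ({j | j ≠ A.kind} : Finset (Fin 3)).image (fun j => (A, j)) := by
    ext ⟨B, j⟩
    simp only [Finset.mem_filter, mem_flags, Finset.mem_image, Finset.mem_univ, true_and,
      Prod.mk.injEq]
    constructor
    · rintro ⟨⟨_, h⟩, rfl⟩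
      exact ⟨j, h, rfl, rfl⟩
    · rintro ⟨i, h, rfl, rfl⟩
      exact ⟨⟨hA, h⟩, rfl⟩
  rw [this, Finset.card_image_of_injective _ (fun i j h => (Prod.mk.inj h).2)]
  have : ∀ k : Fin 3, ({j | j ≠ k} : Finset (Fin 3)).card = 2 := by decide
  exact this _

theorem numRuns_eq_sum (T : Finset Tile) :
    numRuns T = ∑ j, Nat.card {c : Strip T j // c.supp.Nontrivial} := by
  rw [numRuns, Nat.card_sigma]

theorem strip_adj_iff (hT : NoOverlap T) (j : Fin 3) (A B : (T : Set Tile)) :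
    ((stripGraph j).induce (T : Set Tile)).Adj A B ↔ Follows j A.1 B.1 ∨ Follows j B.1 A.1 :=
  stripGraph_adj hT A.2 B.2 j

/-- A run is a directed path and has one first tile, recognised by its shared `uside` and free
`dside`. -/
theorem numRuns_eq_starts (hT : NoOverlap T) : numRuns T = ((flags T).filter fun x => Ush T x ∧ ¬ Dsh T x).card := by
  rw [numRuns_eq_sum, card_flags_filter]
  refine Finset.sum_congr rfl fun j _ => ?_
  rw [card_components (R := fun A B : (T : Set Tile) => Follows j A.1 B.1) (strip_adj_iff hT j)
    (fun A A' B h h' => Subtype.ext (h.left_unique hT A.2 A'.2 h')) (l := fun A => level j A.1)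
    fun A B h => h.level_lt]
  refine Nat.card_congr (Equiv.subtypeEquivRight fun A => ?_)
  have h1 := exists_follows_iff hT A.2 j
  have h2 := exists_follows_iff' hT A.2 j
  simp only [Subtype.exists, Finset.mem_coe, ← not_exists, exists_prop, h1, h2]
  tauto

theorem numRuns_eq_ends (hT : NoOverlap T) : numRuns T = ((flags T).filter fun x => ¬ Ush T x ∧ Dsh T x).card := by
  rw [numRuns_eq_sum, card_flags_filter]
  refine Finset.sum_congr rfl fun j _ => ?_
  rw [card_components (R := fun A B : (T : Set Tile) => Follows j B.1 A.1)
    (fun A B => (strip_adj_iff hT j A B).trans or_comm)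
    (fun A A' B h h' => Subtype.ext (h.right_unique hT A.2 A'.2 h')) (l := fun A => -level j A.1)
    fun A B h => neg_lt_neg h.level_lt]
  refine Nat.card_congr (Equiv.subtypeEquivRight fun A => ?_)
  have h1 := exists_follows_iff hT A.2 j
  have h2 := exists_follows_iff' hT A.2 j
  simp only [Subtype.exists, Finset.mem_coe, ← not_exists, exists_prop, h1, h2]
  tauto

theorem mul_numRuns (hT : NoOverlap T) (hκ : ∀ r : Run T, r.length = κ) :
    κ * numRuns T = ((flags T).filter fun x => Ush T x ∨ Dsh T x).card := by
  rw [numRuns_eq_sum, card_flags_filter, Finset.mul_sum]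
  refine Finset.sum_congr rfl fun j _ => ?_
  rw [← card_nonisolated (G := (stripGraph j).induce (T : Set Tile)) fun c hc => hκ ⟨j, c, hc⟩]
  refine Nat.card_congr (Equiv.subtypeEquivRight fun A => ?_)
  have h1 := exists_follows_iff hT A.2 j
  have h2 := exists_follows_iff' hT A.2 j
  simp only [strip_adj_iff hT, Subtype.exists, Finset.mem_coe, exists_prop, exists_or, and_or_left,
    h1, h2]

/-! ### Leaves -/

/-- Offset between the two triangles at an edge. -/
theorem sides_exchange : ∀ j j' k k' : Fin 3, j ≠ k → j ≠ k' →
    dnOff j - upOff j + (dnOff j' - upOff j') ≠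
      dnOff k - upOff k + (dnOff k' - upOff k') := by decide

/-- Two tiles that do not overlap share at most one side. -/
theorem shared_side_unique {A B : Tile} (h : ∀ t, ¬ (A.Covers t ∧ B.Covers t)) {e e' : Edge}
    (h1 : e ∈ A.sides) (h2 : e ∈ B.sides) (h1' : e' ∈ A.sides) (h2' : e' ∈ B.sides) : e = e' := by
  have aux : ∀ {A B : Tile}, (∀ t, ¬ (A.Covers t ∧ B.Covers t)) → ∀ {e : Edge}, e ∈ A.sides →
      e ∈ B.sides → (upTri e = A.up ∧ dnTri e = B.dn) ∨ (upTri e = B.up ∧ dnTri e = A.dn) := by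
    intro A B h e h1 h2
    rcases ((mem_sides_iff A e).mp h1).2 with hA | hA <;>
      rcases ((mem_sides_iff B e).mp h2).2 with hB | hB
    · exact absurd ⟨hA ▸ covers_up A, hB ▸ covers_up B⟩ (h (upTri e))
    · exact Or.inl ⟨hA, hB⟩
    · exact Or.inr ⟨hB, hA⟩
    · exact absurd ⟨hA ▸ covers_dn A, hB ▸ covers_dn B⟩ (h (dnTri e))
  -- The offsets across `e` and `e'` would have the same sum as those across the two short
  -- diagonals. The three possible offsets are affinely independent, and the direction of `e` is
  -- that of neither diagonal.
  have cross : ∀ {A B : Tile} {e e' : Edge}, e ∈ A.sides → e ∈ B.sides → upTri e = A.up →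
      dnTri e = B.dn → upTri e' = B.up → dnTri e' = A.dn → False := by
    intro A B e e' hA hB a1 a2 a3 a4
    refine sides_exchange e.2 e'.2 A.kind B.kind ((mem_sides_iff A e).mp hA).1
      ((mem_sides_iff B e).mp hB).1 ?_
    have b1 := congrArg Prod.fst a1
    have b2 := congrArg Prod.fst a2
    have b3 := congrArg Prod.fst a3
    have b4 := congrArg Prod.fst a4
    simp only [upTri, dnTri, Tile.up, Tile.dn, Tile.diag] at b1 b2 b3 b4
    linear_combination b1 - b2 + b3 - b4
  rcases aux h h1 h2 with ⟨a1, a2⟩ | ⟨a1, a2⟩ <;> rcases aux h h1' h2' with ⟨b1, b2⟩ | ⟨b1, b2⟩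
  · exact edge_ext (a1.trans b1.symm) (a2.trans b2.symm)
  · exact (cross h1 h2 a1 a2 b1 b2).elim
  · exact (cross h1' h2' b1 b2 a1 a2).elim
  · exact edge_ext (a1.trans b1.symm) (a2.trans b2.symm)

/-- The sides that a tile shares with other tiles of `T`. -/
def sharedSides (T : Finset Tile) (A : Tile) : Finset Edge :=
  {e ∈ A.sides | Cov T (upTri e) ∧ Cov T (dnTri e)}

theorem mem_sharedSides {A : Tile} {e : Edge} :
    e ∈ sharedSides T A ↔ e ∈ A.sides ∧ Cov T (upTri e) ∧ Cov T (dnTri e) := by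
  simp [sharedSides]

/-- A side belongs to at most one other tile, and two tiles share at most one side, so leaves can be
recognised by their shared sides. -/
theorem card_adj (hT : NoOverlap T) {A : Tile} (hA : A ∈ T) :
    ({B ∈ T | adjGraph.Adj A B} : Finset Tile).card = (sharedSides T A).card := by
  symm
  have hex : ∀ e ∈ sharedSides T A, ∃ B ∈ T, B ≠ A ∧ e ∈ B.sides := fun e he =>
    exists_across hT hA (mem_sharedSides.mp he).1 (mem_sharedSides.mp he).2.1
      (mem_sharedSides.mp he).2.2
  have : Nonempty Tile := ⟨A⟩
  choose! f hf1 hf2 hf3 using hex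
  refine Finset.card_bij (fun e _ => f e) (fun e he => ?_) (fun e he e' he' h => ?_)
    (fun B hB => ?_)
  · simp only [Finset.mem_filter]
    exact ⟨hf1 e he, (hf2 e he).symm, e, (mem_sharedSides.mp he).1, hf3 e he⟩
  · refine shared_side_unique (hT A hA (f e) (hf1 e he) (hf2 e he).symm) (mem_sharedSides.mp he).1
      (hf3 e he) (mem_sharedSides.mp he').1 ?_
    rw [h]; exact hf3 e' he'
  · simp only [Finset.mem_filter] at hB
    obtain ⟨hB, hne, e, heA, heB⟩ := hB
    have he : e ∈ sharedSides T A := mem_sharedSides.mpr ⟨heA, cov_of_shared hT hA hB hne heA heB⟩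
    refine ⟨e, he, ?_⟩
    by_contra hcon
    rcases ((mem_sides_iff_xor A e).mp heA) with ⟨h, h'⟩ | ⟨h, h'⟩
    all_goals
      rcases ((mem_sides_iff_xor B e).mp heB) with ⟨k, k'⟩ | ⟨k, k'⟩ <;>
        rcases ((mem_sides_iff_xor _ e).mp (hf3 e he)) with ⟨l, l'⟩ | ⟨l, l'⟩ <;>
          first
            | exact hne (hT.unique hA hB h k)
            | exact hf2 e he (hT.unique (hf1 e he) hA l h)
            | exact hcon (hT.unique (hf1 e he) hB l k)

theorem mem_leaves (hT : NoOverlap T) {A : Tile} :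
    A ∈ leaves T ↔ A ∈ T ∧ (sharedSides T A).card = 1 := by
  simp only [leaves, Finset.mem_filter]
  exact and_congr_right fun hA => by rw [card_adj hT hA]

/-- The shared sides, by flags. -/
theorem card_sharedSides {A : Tile} (hA : A ∈ T) :
    (sharedSides T A).card = (if Ush T (A, A.kind + 1) then 1 else 0) +
      (if Dsh T (A, A.kind + 1) then 1 else 0) + (if Ush T (A, A.kind + 2) then 1 else 0) +
      (if Dsh T (A, A.kind + 2) then 1 else 0) := by
  have h1 : ∀ k : Fin 3, k + 1 ≠ k := by decide
  have h2 : ∀ k : Fin 3, k + 2 ≠ k := by decide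
  have h3 : ∀ k : Fin 3, k + 1 ≠ k + 2 := by decide
  have h4 : ∀ j k : Fin 3, j ≠ k → j = k + 1 ∨ j = k + 2 := by decide
  have hs : A.sides = {A.uside (A.kind + 1), A.dside (A.kind + 1), A.uside (A.kind + 2),
      A.dside (A.kind + 2)} := by
    ext e
    rw [mem_sides_iff_uside]
    simp only [Finset.mem_insert, Finset.mem_singleton]
    constructor
    · rintro ⟨hk, he⟩
      rcases h4 _ _ hk with h | h <;> rw [h] at he <;> tauto
    · rintro (rfl | rfl | rfl | rfl)
      exacts [⟨h1 _, Or.inl rfl⟩, ⟨h1 _, Or.inr rfl⟩, ⟨h2 _, Or.inl rfl⟩, ⟨h2 _, Or.inr rfl⟩]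
  have hu : Cov T A.up := ⟨A, hA, covers_up A⟩
  have hd : Cov T A.dn := ⟨A, hA, covers_dn A⟩
  have n1 : A.uside (A.kind + 1) ≠ A.dside (A.kind + 1) := uside_ne_dside (h1 _)
  have n2 : A.uside (A.kind + 1) ≠ A.uside (A.kind + 2) := fun h => h3 _ (congrArg Prod.snd h)
  have n3 : A.uside (A.kind + 1) ≠ A.dside (A.kind + 2) := uside_ne_dside (h1 _)
  have n4 : A.dside (A.kind + 1) ≠ A.uside (A.kind + 2) := (uside_ne_dside (h2 _)).symm
  have n5 : A.dside (A.kind + 1) ≠ A.dside (A.kind + 2) := fun h => h3 _ (congrArg Prod.snd h)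
  have n6 : A.uside (A.kind + 2) ≠ A.dside (A.kind + 2) := uside_ne_dside (h2 _)
  rw [sharedSides, Finset.card_filter, hs, Finset.sum_insert, Finset.sum_insert,
    Finset.sum_insert, Finset.sum_singleton]
  · simp only [upTri_uside, dnTri_dside, hu, hd, true_and, and_true, add_assoc]
  · simpa using n6
  · simpa using ⟨n4, n5⟩
  · simpa using ⟨n1, n2, n3⟩

theorem sharedSides_nonempty (hT : IsDokuTiling κ T) (hn : 2 ≤ T.card) {A : Tile} (hA : A ∈ T) :
    (sharedSides T A).Nonempty := by
  obtain ⟨B, hB, hne⟩ := Finset.exists_mem_ne hn A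
  obtain ⟨w⟩ := hT.edge_connected ⟨A, hA⟩ ⟨B, hB⟩
  cases w with
  | nil => exact absurd rfl hne
  | @cons _ C _ h _ =>
    obtain ⟨hne', e, heA, heC⟩ := h
    exact ⟨e, mem_sharedSides.mpr ⟨heA, cov_of_shared hT.no_overlap hA C.2 hne' heA heC⟩⟩

/-- The flags both of whose sides are free correspond to the leaves. -/
theorem card_trivial (hT : IsDokuTiling κ T) (hn : 2 ≤ T.card) :
    ((flags T).filter fun x => ¬ Ush T x ∧ ¬ Dsh T x).card = (leaves T).card := by
  have hO : NoOverlap T := hT.no_overlap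
  have h1 : ∀ k : Fin 3, k + 1 ≠ k := by decide
  have h2 : ∀ k : Fin 3, k + 2 ≠ k := by decide
  have h3 : ∀ k : Fin 3, k + 1 ≠ k + 2 := by decide
  have h4 : ∀ j k : Fin 3, j ≠ k → j = k + 1 ∨ j = k + 2 := by decide
  -- A tile with one free direction cannot have both sides of the other direction shared; as it has
  -- some shared side, it is a leaf.
  have m1 : ∀ A ∈ T, ¬ (Ush T (A, A.kind + 1) ∧ Dsh T (A, A.kind + 1) ∧
      ¬ Ush T (A, A.kind + 2) ∧ ¬ Dsh T (A, A.kind + 2)) := fun A hA h =>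
    not_middle hT hA (h1 _) (h2 _) (h3 _) h.1 h.2.1 h.2.2.1 h.2.2.2
  have m2 : ∀ A ∈ T, ¬ (Ush T (A, A.kind + 2) ∧ Dsh T (A, A.kind + 2) ∧
      ¬ Ush T (A, A.kind + 1) ∧ ¬ Dsh T (A, A.kind + 1)) := fun A hA h =>
    not_middle hT hA (h2 _) (h1 _) (h3 _).symm h.1 h.2.1 h.2.2.1 h.2.2.2
  have m3 : ∀ A ∈ T, (sharedSides T A).card ≠ 0 := fun A hA =>
    (Finset.card_pos.mpr (sharedSides_nonempty hT hn hA)).ne'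
  refine Finset.card_bij (fun x _ => x.1) ?_ ?_ ?_
  · rintro ⟨A, j⟩ hx
    simp only [Finset.mem_filter, mem_flags] at hx
    obtain ⟨⟨hA, hj⟩, hu, hd⟩ := hx
    rw [mem_leaves hO]
    refine ⟨hA, ?_⟩
    have m1 := m1 A hA
    have m2 := m2 A hA
    have m3 := m3 A hA
    rw [card_sharedSides hA] at m3 ⊢
    rcases h4 j _ hj with rfl | rfl
    · by_cases c1 : Ush T (A, A.kind + 2) <;> by_cases c2 : Dsh T (A, A.kind + 2) <;>
        simp_all
    · by_cases c1 : Ush T (A, A.kind + 1) <;> by_cases c2 : Dsh T (A, A.kind + 1) <;>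
        simp_all
  · rintro ⟨A, j⟩ hx ⟨B, i⟩ hy hAB
    obtain rfl : A = B := hAB
    simp only [Finset.mem_filter, mem_flags] at hx hy
    obtain ⟨⟨hA, hj⟩, hu, hd⟩ := hx
    obtain ⟨⟨-, hi⟩, hu', hd'⟩ := hy
    have m3 := m3 A hA
    rw [card_sharedSides hA] at m3
    rcases h4 j _ hj with rfl | rfl <;> rcases h4 i _ hi with rfl | rfl <;> simp_all
  · intro A hA
    rw [mem_leaves hO] at hA
    obtain ⟨hA, hc⟩ := hA
    rw [card_sharedSides hA] at hc
    by_cases c : ¬ Ush T (A, A.kind + 1) ∧ ¬ Dsh T (A, A.kind + 1)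
    · exact ⟨(A, A.kind + 1), Finset.mem_filter.mpr ⟨mem_flags.mpr ⟨hA, h1 _⟩, c⟩, rfl⟩
    · refine ⟨(A, A.kind + 2), Finset.mem_filter.mpr ⟨mem_flags.mpr ⟨hA, h2 _⟩, ?_⟩, rfl⟩
      by_cases c1 : Ush T (A, A.kind + 1) <;> by_cases c2 : Dsh T (A, A.kind + 1) <;>
        by_cases c3 : Ush T (A, A.kind + 2) <;> by_cases c4 : Dsh T (A, A.kind + 2) <;>
        simp [c1, c2, c3, c4] at hc c ⊢

/-! ### Counting edges -/

/-- Each tile has two flags. Each run accounts for κ flags, and each leaf for one more, with both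
sides free. -/
theorem mul_numRuns_add (hT : IsDokuTiling κ T) (hn : 2 ≤ T.card) :
    κ * numRuns T + (leaves T).card = 2 * T.card := by
  rw [mul_numRuns hT.no_overlap hT.run_length, ← card_trivial hT hn, ← card_flags]
  simp only [← not_or]
  exact Finset.card_filter_add_card_filter_not _

theorem card_not_Dsh (hT : IsDokuTiling κ T) (hn : 2 ≤ T.card) :
    ((flags T).filter fun x => ¬ Dsh T x).card = numRuns T + (leaves T).card := by
  rw [numRuns_eq_starts hT.no_overlap, ← card_trivial hT hn,
    ← Finset.card_filter_add_card_filter_not (s := (flags T).filter fun x => ¬ Dsh T x) (Ush T),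
    Finset.filter_filter, Finset.filter_filter]
  simp only [and_comm]

theorem card_not_Ush (hT : IsDokuTiling κ T) (hn : 2 ≤ T.card) :
    ((flags T).filter fun x => ¬ Ush T x).card = numRuns T + (leaves T).card := by
  rw [numRuns_eq_ends hT.no_overlap, ← card_trivial hT hn,
    ← Finset.card_filter_add_card_filter_not (s := (flags T).filter fun x => ¬ Ush T x) (Dsh T),
    Finset.filter_filter, Finset.filter_filter]

theorem uside_injOn (hT : NoOverlap T) :
    Set.InjOn (fun x : Tile × Fin 3 => x.1.uside x.2) (flags T) := by
  rintro ⟨A, j⟩ hx ⟨B, i⟩ hy h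
  obtain rfl : j = i := congrArg Prod.snd h
  have hA := (mem_flags.mp hx).1
  have hB := (mem_flags.mp hy).1
  simp only at h hA hB
  have : A = B := hT.unique hA hB (t := A.up) (covers_up A) (by
    rw [← upTri_uside A j, h, upTri_uside]; exact covers_up B)
  rw [this]

theorem dside_injOn (hT : NoOverlap T) :
    Set.InjOn (fun x : Tile × Fin 3 => x.1.dside x.2) (flags T) := by
  rintro ⟨A, j⟩ hx ⟨B, i⟩ hy h
  obtain rfl : j = i := congrArg Prod.snd h
  have hA := (mem_flags.mp hx).1
  have hB := (mem_flags.mp hy).1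
  simp only at h hA hB
  have : A = B := hT.unique hA hB (t := A.dn) (covers_dn A) (by
    rw [← dnTri_dside A j, h, dnTri_dside]; exact covers_dn B)
  rw [this]

/-- A shared `dside` is the `uside` of the tile across it, so only free ones need to be added. -/
theorem edges_subset (hT : NoOverlap T) : edges T ⊆
    (flags T).image (fun x => x.1.uside x.2) ∪
      ((flags T).filter fun x => ¬ Dsh T x).image (fun x => x.1.dside x.2) := by
  intro e he
  obtain ⟨A, hA, he⟩ := mem_edges.mp he
  obtain ⟨hk, h⟩ := (mem_sides_iff_uside A e).mp he
  simp only [Finset.mem_union, Finset.mem_image, Finset.mem_filter, mem_flags]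
  rcases h with h | h
  · exact Or.inl ⟨(A, e.2), ⟨hA, hk⟩, h.symm⟩
  · by_cases hc : Dsh T (A, e.2)
    · obtain ⟨B, hB, hne, hBe⟩ := exists_across hT hA he (by rwa [h])
        ⟨A, hA, by rw [h, dnTri_dside]; exact covers_dn A⟩
      obtain ⟨hk', h'⟩ := (mem_sides_iff_uside B e).mp hBe
      rcases h' with h' | h'
      · exact Or.inl ⟨(B, e.2), ⟨hB, hk'⟩, h'.symm⟩
      · exact absurd (hT.unique hB hA (t := dnTri e) (by rw [h', dnTri_dside]; exact covers_dn B)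
          (by rw [h, dnTri_dside]; exact covers_dn A)) hne
    · exact Or.inr ⟨(A, e.2), ⟨⟨hA, hk⟩, hc⟩, h.symm⟩

theorem card_edges_le (hT : IsDokuTiling κ T) (hn : 2 ≤ T.card) :
    (edges T).card ≤ 2 * T.card + numRuns T + (leaves T).card := by
  have h1 := Finset.card_le_card (edges_subset hT.no_overlap)
  have h2 := Finset.card_union_le ((flags T).image (fun x => x.1.uside x.2))
    (((flags T).filter fun x => ¬ Dsh T x).image (fun x => x.1.dside x.2))
  have h3 := Finset.card_image_le (s := flags T) (f := fun x => x.1.uside x.2)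
  have h4 := Finset.card_image_le (s := (flags T).filter fun x => ¬ Dsh T x)
    (f := fun x => x.1.dside x.2)
  rw [card_not_Dsh hT hn] at h4
  rw [card_flags] at h3
  omega

theorem card_verts_le (hT : IsDokuTiling κ T) (hn : 2 ≤ T.card) :
    (verts T).card ≤ T.card + numRuns T + (leaves T).card + 1 := by
  have h1 := euler hT.no_overlap hT.edge_connected.preconnected (Finset.card_pos.mp (by omega))
  have h2 := card_edges_le hT hn
  omega

/-! ### Counting angles -/

/-- The number of uncovered triangles at a vertex. -/
def outDeg (T : Finset Tile) (v : Vertex) : ℕ := ({s | ¬ Cov T (tri v s)} : Finset (ZMod 6)).card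

/-- The number of covered triangles at a vertex. -/
def inDeg (T : Finset Tile) (v : Vertex) : ℕ := ({s | Cov T (tri v s)} : Finset (ZMod 6)).card

/-- The number of blocks of covered triangles at a vertex with covered and uncovered triangles. -/
def blocks (T : Finset Tile) (v : Vertex) : ℕ :=
  ({s | ¬ Cov T (tri v s) ∧ Cov T (tri v (s + 1))} : Finset (ZMod 6)).card

theorem inDeg_add_outDeg (T : Finset Tile) (v : Vertex) : inDeg T v + outDeg T v = 6 :=
  Finset.card_filter_add_card_filter_not (s := (Finset.univ : Finset (ZMod 6)))
    (fun s => Cov T (tri v s))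

theorem mem_verts_of_cov {v : Vertex} {s : ZMod 6} (h : Cov T (tri v s)) : v ∈ verts T := by
  obtain ⟨A, hA, h⟩ := h
  exact mem_verts.mpr ⟨A, hA, (mem_vertices_iff_tri A v).mpr ⟨s, h⟩⟩

theorem card_triangle_vertices (t : Triangle) : (Triangle.vertices t).card = 3 := by
  obtain ⟨⟨a, b⟩, _ | _⟩ := t <;> simp [Triangle.vertices, dir]

/-- Each tile consists of two triangles with three corners each, and every such corner is a covered
position at a vertex. -/
theorem six_mul_card_le (hT : NoOverlap T) : 6 * T.card ≤ ∑ v ∈ verts T, inDeg T v := by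
  have hsum : ∑ v ∈ verts T, inDeg T v =
      ((verts T).sigma fun v => ({s | Cov T (tri v s)} : Finset (ZMod 6))).card :=
    (Finset.card_sigma _ _).symm
  set C : Finset Triangle := T.biUnion fun A => {A.up, A.dn} with hC
  have hCcard : C.card = T.card * 2 := by
    rw [hC, Finset.card_biUnion, Finset.sum_const_nat]
    · intro A _
      exact Finset.card_pair (upTri_ne_dnTri _ _)
    · intro A hA B hB hne
      refine Finset.disjoint_left.mpr fun t htA htB => ?_
      simp only [Finset.mem_insert, Finset.mem_singleton] at htA htB
      exact hT A hA B hB hne t ⟨(covers_iff A t).mpr htA, (covers_iff B t).mpr htB⟩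
  have hP : (C.sigma fun t => Triangle.vertices t).card = 6 * T.card := by
    rw [Finset.card_sigma, Finset.sum_const_nat (fun t _ => card_triangle_vertices t), hCcard]
    ring
  rw [hsum, ← hP]
  refine Finset.card_le_card_of_surjOn
    (fun x : (_ : Vertex) × ZMod 6 => (⟨tri x.1 x.2, x.1⟩ : (_ : Triangle) × Vertex)) ?_
  rintro ⟨t, v⟩ h
  simp only [Finset.coe_sigma, Set.mem_sigma_iff, Finset.mem_coe, hC, Finset.mem_biUnion,
    Finset.mem_insert, Finset.mem_singleton] at h
  obtain ⟨⟨A, hA, ht⟩, hv⟩ := h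
  obtain ⟨s, rfl⟩ := exists_tri hv
  have hc : Cov T (tri v s) := ⟨A, hA, (covers_iff A _).mpr ht⟩
  refine ⟨⟨v, s⟩, ?_, rfl⟩
  simp only [Finset.coe_sigma, Set.mem_sigma_iff, Finset.mem_coe, Finset.mem_filter,
    Finset.mem_univ, true_and]
  exact ⟨mem_verts_of_cov hc, hc⟩

theorem sum_outDeg_le (hT : IsDokuTiling κ T) (hn : 2 ≤ T.card) :
    ∑ v ∈ verts T, outDeg T v ≤ 6 * (numRuns T + (leaves T).card + 1) := by
  have h1 := six_mul_card_le hT.no_overlap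
  have h2 : ∑ v ∈ verts T, inDeg T v + ∑ v ∈ verts T, outDeg T v = (verts T).card * 6 := by
    rw [← Finset.sum_add_distrib, Finset.sum_const_nat fun v _ => inDeg_add_outDeg T v]
  have h3 := card_verts_le hT hn
  omega

/-- Every edge with just one covered triangle starts a block at one of its end points. -/
theorem exists_transition {e : Edge}
    (h : (Cov T (upTri e) ∧ ¬ Cov T (dnTri e)) ∨ (¬ Cov T (upTri e) ∧ Cov T (dnTri e))) :
    ∃ v s, e = edgeAt v (s + 1) ∧ ¬ Cov T (tri v s) ∧ Cov T (tri v (s + 1)) := by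
  obtain ⟨r, hr⟩ := (mem_ends_iff e.1 e).mp (mem_ends.mpr (Or.inl rfl))
  set v := e.1
  have h' : (Cov T (tri v r) ∧ ¬ Cov T (tri v (r - 1))) ∨
      (¬ Cov T (tri v r) ∧ Cov T (tri v (r - 1))) := by
    rcases edgeAt_tri v r with ⟨h1, h2⟩ | ⟨h1, h2⟩ <;> rw [← hr] at h1 h2 <;> rw [h1, h2] at h <;>
      tauto
  rcases h' with ⟨h1, h2⟩ | ⟨h1, h2⟩
  · exact ⟨v, r - 1, by rwa [sub_add_cancel], h2, by rwa [sub_add_cancel]⟩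
  -- Seen from the other end, the two triangles at the edge have the opposite cyclic order, and the
  -- edge has index `r + 3`.
  · refine ⟨v + hexDir r, r + 2, ?_, by rwa [tri_hexDir], ?_⟩
    · rw [add_assoc, show (2 : ZMod 6) + 1 = 3 by rfl, edgeAt_hexDir, hr]
    · have := tri_hexDir_succ v (r - 1)
      rw [sub_add_cancel, show r - 1 + 4 = r + 2 + 1 by ring] at this
      rwa [this]

/-- The free `uside`s and the free `dside`s number ρ + λ each, and are disjoint because their
covered triangles have different types. Each starts a block at one of its ends, and the start of a
block determines the edge. -/
theorem le_sum_blocks (hT : IsDokuTiling κ T) (hn : 2 ≤ T.card) :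
    2 * (numRuns T + (leaves T).card) ≤ ∑ v ∈ verts T, blocks T v := by
  have hO : NoOverlap T := hT.no_overlap
  have hsum : ∑ v ∈ verts T, blocks T v = ((verts T).sigma fun v =>
      ({s | ¬ Cov T (tri v s) ∧ Cov T (tri v (s + 1))} : Finset (ZMod 6))).card :=
    (Finset.card_sigma _ _).symm
  set Bu := ((flags T).filter fun x => ¬ Ush T x).image (fun x => x.1.uside x.2) with hBu
  set Bd := ((flags T).filter fun x => ¬ Dsh T x).image (fun x => x.1.dside x.2) with hBd
  have hBuc : Bu.card = numRuns T + (leaves T).card := by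
    rw [hBu, Finset.card_image_of_injOn ((uside_injOn hO).mono (Finset.coe_subset.mpr (Finset.filter_subset _ _))), card_not_Ush hT hn]
  have hBdc : Bd.card = numRuns T + (leaves T).card := by
    rw [hBd, Finset.card_image_of_injOn ((dside_injOn hO).mono (Finset.coe_subset.mpr (Finset.filter_subset _ _))), card_not_Dsh hT hn]
  have hu : ∀ e ∈ Bu, Cov T (upTri e) ∧ ¬ Cov T (dnTri e) := by
    intro e he
    simp only [hBu, Finset.mem_image, Finset.mem_filter, mem_flags] at he
    obtain ⟨⟨A, j⟩, ⟨⟨hA, -⟩, hs⟩, rfl⟩ := he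
    exact ⟨⟨A, hA, by rw [upTri_uside]; exact covers_up A⟩, hs⟩
  have hd : ∀ e ∈ Bd, ¬ Cov T (upTri e) ∧ Cov T (dnTri e) := by
    intro e he
    simp only [hBd, Finset.mem_image, Finset.mem_filter, mem_flags] at he
    obtain ⟨⟨A, j⟩, ⟨⟨hA, -⟩, hs⟩, rfl⟩ := he
    exact ⟨hs, ⟨A, hA, by rw [dnTri_dside]; exact covers_dn A⟩⟩
  have hdisj : Disjoint Bu Bd := Finset.disjoint_left.mpr fun e h1 h2 => (hd e h2).1 (hu e h1).1
  have hcard : (Bu ∪ Bd).card = 2 * (numRuns T + (leaves T).card) := by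
    rw [Finset.card_union_of_disjoint hdisj, hBuc, hBdc]; ring
  rw [hsum, ← hcard]
  refine Finset.card_le_card_of_surjOn
    (fun x : (_ : Vertex) × ZMod 6 => edgeAt x.1 (x.2 + 1)) fun e he => ?_
  obtain ⟨v, s, rfl, h1, h2⟩ := exists_transition (T := T) (e := e) (by
    rcases Finset.mem_union.mp (Finset.mem_coe.mp he) with h | h
    exacts [Or.inl (hu e h), Or.inr (hd e h)])
  refine ⟨⟨v, s⟩, ?_, rfl⟩
  simp only [Finset.coe_sigma, Set.mem_sigma_iff, Finset.mem_coe, Finset.mem_filter,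
    Finset.mem_univ, true_and]
  exact ⟨mem_verts_of_cov h2, h1, h2⟩

/-! ### Notches -/

theorem tri_adj {c : Vertex} {r : ZMod 6} {t : Triangle} (h : triangleGraph.Adj (tri c r) t) :
    t = tri c (r + 1) ∨ t = tri c (r - 1) ∨ t = tri (c + hexDir r) (r + 1) := by
  obtain ⟨e, he⟩ := triangle_adj h
  have key : ∀ (x : Vertex) (s : ZMod 6) (t' : Triangle), edgeKind s = e.2 →
      ((tri x s = tri c r ∧ tri x (s - 1) = t') ∨ (tri x (s - 1) = tri c r ∧ tri x s = t')) →
      t = t' := by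
    intro x s t' hs ht'
    rcases he with ⟨h1, rfl⟩ | ⟨h1, rfl⟩ <;> rcases ht' with ⟨h2, rfl⟩ | ⟨h2, rfl⟩ <;>
      rcases edgeAt_tri x s with ⟨h3, h4⟩ | ⟨h3, h4⟩
    · rw [edge_ext_up (h1.symm.trans (h2.symm.trans h3.symm)) hs.symm, h4]
    · exact absurd (h4.trans (h2.trans h1)).symm (upTri_ne_dnTri _ _)
    · exact absurd (h4.trans (h2.trans h1)).symm (upTri_ne_dnTri _ _)
    · rw [edge_ext_up (h1.symm.trans (h2.symm.trans h3.symm)) hs.symm, h4]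
    · exact absurd (h3.trans (h2.trans h1)) (upTri_ne_dnTri _ _)
    · rw [edge_ext_dn (h1.symm.trans (h2.symm.trans h4.symm)) hs.symm, h3]
    · rw [edge_ext_dn (h1.symm.trans (h2.symm.trans h4.symm)) hs.symm, h3]
    · exact absurd (h3.trans (h2.trans h1)) (upTri_ne_dnTri _ _)
  have kinds : ∀ (r : ZMod 6) (j : Fin 3), edgeKind r = j ∨ edgeKind (r + 1) = j ∨
      edgeKind (r + 2) = j := by decide
  rcases kinds r e.2 with hk | hk | hk
  · exact Or.inr (Or.inl (key c r _ hk (Or.inl ⟨rfl, rfl⟩)))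
  · exact Or.inl (key c (r + 1) _ hk (Or.inr ⟨by rw [add_sub_cancel_right], rfl⟩))
  · refine Or.inr (Or.inr (key (c + hexDir r) (r + 2) _ hk (Or.inl ⟨tri_hexDir c r, ?_⟩)))
    congr 1
    ring

/-- A walk around the point `c`: the first triangles at `c`, from the position `p` on, are
uncovered, the triangles beyond them are covered, and the vertices between these have just two
uncovered triangles. -/
def WalkTo (T : Finset Tile) (c : Vertex) (p : ZMod 6) (i : ℕ) : Prop :=
  (∀ j : ℕ, j ≤ i → ¬ Cov T (tri c (p + j)) ∧ Cov T (tri (c + hexDir (p + j)) (p + j + 1))) ∧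
    ∀ j : ℕ, 1 ≤ j → j ≤ i → outDeg T (c + hexDir (p + j)) = 2

/-- The pivot `c` is the last corner of the only uncovered triangle `tri v s`, which has index `s +
4` when seen from `c`. The triangle beyond it and the one before it at `c` are both among the five
covered triangles at `v`. -/
theorem exists_walk {v : Vertex} (hv : outDeg T v = 1) :
    ∃ c p, v = c + hexDir p ∧ WalkTo T c p 0 ∧ Cov T (tri c (p + 5)) := by
  obtain ⟨s, hs⟩ := Finset.card_eq_one.mp hv
  have h : ∀ r, ¬ Cov T (tri v r) ↔ r = s := fun r => by
    have := Finset.ext_iff.mp hs r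
    simpa using this
  have h' : ∀ r, r ≠ s → Cov T (tri v r) := fun r hr => by
    by_contra hc
    exact hr ((h r).mp hc)
  have hv : v = v + hexDir (s + 1) + hexDir (s + 4) := by
    rw [show s + 4 = s + 1 + 3 by ring, hexDir_add_three, add_neg_cancel_right]
  have n5 : ∀ s : ZMod 6, s + 4 + 1 ≠ s := by decide
  have n1 : ∀ s : ZMod 6, s + 1 ≠ s := by decide
  refine ⟨v + hexDir (s + 1), s + 4, hv, ⟨fun j hj => ?_, fun j h1 h2 => absurd h1 (by omega)⟩, ?_⟩
  · obtain rfl : j = 0 := by omega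
    rw [Nat.cast_zero, add_zero, tri_hexDir_succ, ← hv]
    exact ⟨(h s).mpr rfl, h' _ (n5 s)⟩
  · have := tri_hexDir v (s + 1)
    rw [show s + 4 + 5 = s + 1 + 2 + 6 by ring, show (6 : ZMod 6) = 0 by rfl, add_zero, this]
    exact h' _ (n1 s)

/-- Otherwise the uncovered triangles of the walk would be sealed off by the covered ones before,
after and beyond them, and form a hole. -/
theorem WalkTo.not_cov (hT : NoHoles T) {c : Vertex} {p : ZMod 6} {i : ℕ} (h : WalkTo T c p i)
    (hp : Cov T (tri c (p + 5))) : ¬ Cov T (tri c (p + (i + 1 : ℕ))) := by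
  intro hi
  obtain ⟨M, hM⟩ := exists_bound T
  -- Uncovered, and too far to the right to be a triangle at `c`.
  set t : Triangle := ((max M (c.1 + 1), 0), true)
  have ht : ¬ Cov T t := fun h => absurd (hM t h) (not_lt.mpr (le_max_left _ _))
  have hstep : ∀ t t', ¬ Cov T t → ¬ Cov T t' → triangleGraph.Adj t t' →
      (∃ j ≤ i, t = tri c (p + (j : ℕ))) → ∃ j ≤ i, t' = tri c (p + (j : ℕ)) := by
    rintro _ t' - ht' hadj ⟨j, hj, rfl⟩
    rcases tri_adj hadj with rfl | rfl | rfl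
    · rcases hj.lt_or_eq with hj | rfl
      · exact ⟨j + 1, hj, by push_cast; ring_nf⟩
      · refine absurd hi ?_
        rwa [Nat.cast_succ, ← add_assoc]
    · rcases Nat.eq_zero_or_pos j with rfl | h0
      · refine absurd hp ?_
        rwa [Nat.cast_zero, add_zero, sub_eq_add_neg, show (-1 : ZMod 6) = 5 by rfl] at ht'
      · exact ⟨j - 1, by omega, by rw [Nat.cast_pred h0]; ring_nf⟩
    · exact absurd (h.1 j hj).2 ht'
  obtain ⟨j, -, hj⟩ := hT.induction hstep (h.1 0 (Nat.zero_le _)).1 ⟨0, Nat.zero_le _, rfl⟩ ht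
  have h1 := congrArg (fun t : Triangle => t.1.1) hj
  have h2 : ∀ s, 0 ≤ (triOff s).1 := by decide
  have h3 := h2 (p + (j : ℕ))
  have h4 : c.1 + 1 ≤ max M (c.1 + 1) := le_max_right _ _
  simp only [t, tri, Prod.fst_sub] at h1
  omega

theorem tri_tip (c : Vertex) (q : ZMod 6) :
    tri (c + hexDir (q + 1)) (q + 5) = tri (c + hexDir q) (q + 1) ∧
    tri (c + hexDir (q + 1)) (q + 3) = tri c (q + 1) := by
  constructor
  · have := tri_hexDir_succ (c + hexDir q) (q + 1)
    rw [show q + 1 + 1 = q + 2 by ring, add_assoc c, hexDir_add_two,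
      show q + 1 + 4 = q + 5 by ring] at this
    exact this
  · have := tri_hexDir c (q + 1)
    rwa [show q + 1 + 2 = q + 3 by ring] at this

/-- The triangles on both sides of the edge from `c` to the next vertex are uncovered. If that
vertex has fewer than three uncovered triangles, these are all, and the next outer triangle is
covered. -/
theorem WalkTo.succ (hT : NoHoles T) {c : Vertex} {p : ZMod 6} {i : ℕ} (h : WalkTo T c p i)
    (hp : Cov T (tri c (p + 5))) (hw : outDeg T (c + hexDir (p + i + 1)) < 3) :
    WalkTo T c p (i + 1) := by
  have hn := h.not_cov hT hp
  have hi := h.1 i le_rfl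
  set q : ZMod 6 := p + i with hq
  have hcast : p + ((i + 1 : ℕ) : ZMod 6) = q + 1 := by push_cast; rw [hq]; ring
  rw [hcast] at hn
  have n1 : ∀ q : ZMod 6, q + 4 ≠ q + 3 ∧ q + 4 ≠ q + 2 ∧ q + 3 ≠ q + 2 := by decide
  have hsub : ({q + 4, q + 3} : Finset (ZMod 6)) ⊆
      ({s | ¬ Cov T (tri (c + hexDir (q + 1)) s)} : Finset (ZMod 6)) := by
    intro s hs
    simp only [Finset.mem_insert, Finset.mem_singleton] at hs
    simp only [Finset.mem_filter, Finset.mem_univ, true_and]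
    rcases hs with rfl | rfl
    · rw [tri_hexDir_succ]; exact hi.1
    · rw [(tri_tip c q).2]; exact hn
  have hcard := Finset.card_le_card hsub
  rw [Finset.card_pair (n1 q).1] at hcard
  change 2 ≤ outDeg T _ at hcard
  have h2 : outDeg T (c + hexDir (q + 1)) = 2 := by omega
  have hE : Cov T (tri (c + hexDir (q + 1)) (q + 1 + 1)) := by
    by_contra hE
    have hsub' : ({q + 4, q + 3, q + 2} : Finset (ZMod 6)) ⊆
        ({s | ¬ Cov T (tri (c + hexDir (q + 1)) s)} : Finset (ZMod 6)) := by
      intro s hs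
      simp only [Finset.mem_insert, Finset.mem_singleton] at hs
      rcases hs with rfl | rfl | rfl
      · exact hsub (by simp)
      · exact hsub (by simp)
      · simp only [Finset.mem_filter, Finset.mem_univ, true_and]
        rwa [show q + 1 + 1 = q + 2 by ring] at hE
    have hcard' := Finset.card_le_card hsub'
    rw [Finset.card_eq_three.mpr ⟨_, _, _, (n1 q).1, (n1 q).2.1, (n1 q).2.2, rfl⟩] at hcard'
    change 3 ≤ outDeg T _ at hcard'
    omega
  refine ⟨fun j hj => ?_, fun j h1 hj => ?_⟩
  · rcases hj.lt_or_eq with hj | rfl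
    · exact h.1 j (by omega)
    · rw [hcast]; exact ⟨hn, hE⟩
  · rcases hj.lt_or_eq with hj | rfl
    · exact h.2 j h1 (by omega)
    · rw [hcast]; exact h2

/-- A walk that never stopped would turn around `c` as far as position `p + 5`, which is covered. -/
theorem exists_target (hT : NoHoles T) {c : Vertex} {p : ZMod 6} (h : WalkTo T c p 0)
    (hp : Cov T (tri c (p + 5))) : ∃ i : ℕ, WalkTo T c p i ∧
      ((∃ A ∈ leaves T, A.Covers (tri (c + hexDir (p + i)) (p + i + 1))) ∨
        (3 ≤ outDeg T (c + hexDir (p + i + 1)) ∧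
          ∃ A ∈ T, A ∉ leaves T ∧ A.Covers (tri (c + hexDir (p + i)) (p + i + 1)))) := by
  by_contra! hcon
  have hall : ∀ i, WalkTo T c p i := by
    intro i
    induction i with
    | zero => exact h
    | succ i ih =>
      obtain ⟨h1, h2⟩ := hcon i ih
      obtain ⟨A, hA, hc⟩ := (ih.1 i le_rfl).2
      refine ih.succ hT hp ?_
      by_contra hlt
      exact h2 (not_lt.mp hlt) A hA (fun hl => h1 A hl hc) hc
  exact ((hall 5).1 5 le_rfl).1 hp

/-- From the end vertex, the last uncovered triangle and the covered one beyond it have indices `q +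
4` and `q + 5`. They mark the start of the only block there, which determines `q` and then `c`. -/
theorem vertex_target_unique (hT : IsDokuTiling κ T) {c c' : Vertex} {q q' : ZMod 6}
    (h1 : ¬ Cov T (tri c q)) (h2 : Cov T (tri (c + hexDir q) (q + 1)))
    (h1' : ¬ Cov T (tri c' q')) (h2' : Cov T (tri (c' + hexDir q') (q' + 1)))
    (h : c + hexDir (q + 1) = c' + hexDir (q' + 1)) : c = c' ∧ q = q' := by
  rw [← tri_hexDir_succ] at h1 h1'
  rw [← (tri_tip _ _).1] at h2 h2'
  rw [← h] at h1' h2'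
  have := transition_unique hT h1 (by rwa [show q + 4 + 1 = q + 5 by ring]) h1'
    (by rwa [show q' + 4 + 1 = q' + 5 by ring])
  obtain rfl := add_right_cancel this
  exact ⟨add_right_cancel h, rfl⟩

theorem covers_end_unique {A : Tile} {v : Vertex} {r r' : ZMod 6} (h1 : A.Covers (tri v r))
    (h2 : ¬ A.Covers (tri v (r + 1))) (h1' : A.Covers (tri v r'))
    (h2' : ¬ A.Covers (tri v (r' + 1))) : r = r' := by
  rcases covers_two h1 h1' with h | h | h
  · exact h.symm
  · exact absurd (h ▸ h1') h2
  · exact absurd (h ▸ h1) h2'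

theorem edgeAt_eq {v v' : Vertex} {s s' : ZMod 6} (h : edgeAt v s = edgeAt v' s') :
    (v = v' ∧ s = s') ∨ (v' = v + hexDir s ∧ s' = s + 3) := by
  have hv' : v' ∈ ends (edgeAt v s) := by rw [h, edgeAt_ends]; simp
  rw [edgeAt_ends, Finset.mem_insert, Finset.mem_singleton] at hv'
  rcases hv' with rfl | rfl
  · exact Or.inl ⟨rfl, edgeAt_injective _ h⟩
  · rw [← edgeAt_hexDir] at h
    exact Or.inr ⟨rfl, (edgeAt_injective _ h).symm⟩

theorem cov_edgeAt (T : Finset Tile) (v : Vertex) (s : ZMod 6) :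
    (Cov T (upTri (edgeAt v s)) ∧ Cov T (dnTri (edgeAt v s))) ↔
      (Cov T (tri v s) ∧ Cov T (tri v (s - 1))) := by
  rcases edgeAt_tri v s with ⟨h1, h2⟩ | ⟨h1, h2⟩ <;> rw [h1, h2]
  exact and_comm

theorem edgeAt_mem_sides (A : Tile) (v : Vertex) (s : ZMod 6) :
    edgeAt v s ∈ A.sides ↔ Xor (A.Covers (tri v s)) (A.Covers (tri v (s - 1))) := by
  rw [mem_sides_iff_xor]
  rcases edgeAt_tri v s with ⟨h1, h2⟩ | ⟨h1, h2⟩ <;> rw [h1, h2]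
  exact iff_of_eq (_root_.xor_comm _ _)

theorem card_covers_le (A : Tile) (v : Vertex) :
    ({s | A.Covers (tri v s)} : Finset (ZMod 6)).card ≤ 2 := by
  calc _ = (({s | A.Covers (tri v s)} : Finset (ZMod 6)).image (tri v)).card :=
        (Finset.card_image_of_injective _ (tri_injective v)).symm
    _ ≤ ({A.up, A.dn} : Finset Triangle).card := Finset.card_le_card fun t ht => by
        simp only [Finset.mem_image, Finset.mem_filter, Finset.mem_univ, true_and] at ht
        obtain ⟨s, hs, rfl⟩ := ht
        simpa using (covers_iff A _).mp hs
    _ ≤ 2 := Finset.card_le_two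

/-- At least four triangles at `x` are covered, at most two of them by `A`, so by `no_pinch` `A`
shares a side there. The uncovered triangle after `A` forces this to be the side where the angle of
`A` begins. -/
theorem exists_shared_start (hT : IsDokuTiling κ T) {A : Tile} (hA : A ∈ T) {x : Vertex}
    {q : ZMod 6} (h1 : A.Covers (tri x q)) (h2 : ¬ Cov T (tri x (q + 1)))
    (h3 : outDeg T x ≤ 2) : ∃ a, A.Covers (tri x a) ∧ ¬ A.Covers (tri x (a - 1)) ∧
      edgeAt x a ∈ sharedSides T A := by
  by_contra! hcon
  have hall : ∀ r, Cov T (tri x r) → A.Covers (tri x r) := by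
    intro r hr
    have := no_pinch hT x (fun r => if A.Covers (tri x r) then 1 else 0) ?_ ⟨A, hA, h1⟩ hr
    · by_contra hc
      simp [h1, hc] at this
    · intro s hs hs'
      by_cases c1 : A.Covers (tri x s) <;> by_cases c2 : A.Covers (tri x (s + 1)) <;>
        simp only [c1, c2]
      · have := covers_end_unique h1 (fun h => h2 ⟨A, hA, h⟩) c1 c2
        exact absurd hs' (this ▸ h2)
      · have hss : s + 1 - 1 = s := by ring
        refine absurd (mem_sharedSides.mpr ⟨?_, ?_⟩) (hcon (s + 1) c2 (by rwa [hss]))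
        · rw [edgeAt_mem_sides, hss]
          exact Or.inl ⟨c2, c1⟩
        · rw [cov_edgeAt, hss]
          exact ⟨hs', hs⟩
  have hle : inDeg T x ≤ 2 := (Finset.card_le_card fun s hs => by
    simp only [Finset.mem_filter, Finset.mem_univ, true_and] at hs ⊢
    exact hall s hs).trans (card_covers_le A x)
  have := inDeg_add_outDeg T x
  omega

/-- A leaf has only one shared side, and its angle begins with that side, counterclockwise, at just
one of the two ends. -/
theorem leaf_target_unique (hT : IsDokuTiling κ T) {A : Tile} (hA : A ∈ leaves T) {x x' : Vertex}
    {q q' : ZMod 6} (h1 : A.Covers (tri x q)) (h2 : ¬ Cov T (tri x (q + 1)))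
    (h3 : outDeg T x ≤ 2) (h1' : A.Covers (tri x' q')) (h2' : ¬ Cov T (tri x' (q' + 1)))
    (h3' : outDeg T x' ≤ 2) : x = x' ∧ q = q' := by
  obtain ⟨hA, hc⟩ := (mem_leaves hT.no_overlap).mp hA
  obtain ⟨a, ha, hb, hs⟩ := exists_shared_start hT hA h1 h2 h3
  obtain ⟨a', ha', hb', hs'⟩ := exists_shared_start hT hA h1' h2' h3'
  have hx : x = x' := by
    rcases edgeAt_eq (Finset.card_le_one.mp hc.le _ hs _ hs') with ⟨h, -⟩ | ⟨rfl, rfl⟩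
    · exact h
    · have := tri_hexDir_succ x (a - 1)
      rw [sub_add_cancel, show a - 1 + 4 = a + 3 by ring] at this
      exact absurd (this ▸ ha') hb
  subst hx
  exact ⟨rfl, covers_end_unique h1 (fun h => h2 ⟨A, hA, h⟩) h1' fun h => h2' ⟨A, hA, h⟩⟩

/-- Later vertices of a walk have two uncovered triangles and a notch has one, so neither walk can
pass through the start of the other. -/
theorem WalkTo.start_unique {c : Vertex} {p p' : ZMod 6} {i i' : ℕ} (h : WalkTo T c p i)
    (h' : WalkTo T c p' i') (he : p + i = p' + i') (hp : outDeg T (c + hexDir p) = 1)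
    (hp' : outDeg T (c + hexDir p') = 1) : p = p' := by
  wlog hle : i ≤ i' generalizing p p' i i'
  · exact (this h' h he.symm hp' hp (by omega)).symm
  rcases hle.lt_or_eq with hlt | rfl
  · have hpe : p = p' + ((i' - i : ℕ) : ZMod 6) := by
      rw [Nat.cast_sub hle]
      linear_combination he
    have := h'.2 (i' - i) (by omega) (by omega)
    rw [← hpe, hp] at this
    omega
  · exact add_right_cancel he

theorem WalkTo.outDeg_le {c : Vertex} {p : ZMod 6} {i : ℕ} (h : WalkTo T c p i)
    (hp : outDeg T (c + hexDir p) = 1) : outDeg T (c + hexDir (p + i)) ≤ 2 := by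
  rcases Nat.eq_zero_or_pos i with rfl | h0
  · simp [hp]
  · exact (h.2 i h0 le_rfl).le

/-- The walk that starts at the notch `v` ends at `x`. -/
def Target (T : Finset Tile) (v : Vertex) (x : Tile ⊕ Vertex) : Prop :=
  ∃ c p, ∃ i : ℕ, v = c + hexDir p ∧ WalkTo T c p i ∧
    Sum.elim (fun A => A ∈ leaves T ∧ A.Covers (tri (c + hexDir (p + i)) (p + i + 1)))
      (fun w => w = c + hexDir (p + i + 1)) x

theorem Target.unique (hT : IsDokuTiling κ T) {v v' : Vertex} {x : Tile ⊕ Vertex}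
    (hv : outDeg T v = 1) (hv' : outDeg T v' = 1) (h : Target T v x) (h' : Target T v' x) :
    v = v' := by
  obtain ⟨c, p, i, rfl, hw, hx⟩ := h
  obtain ⟨c', p', i', rfl, hw', hx'⟩ := h'
  have h1 := hw.1 i le_rfl
  have h1' := hw'.1 i' le_rfl
  suffices h : c = c' ∧ p + i = p' + i' by
    obtain ⟨rfl, h⟩ := h
    rw [hw.start_unique hw' h hv hv']
  rcases x with A | w
  · obtain ⟨hA, hx⟩ := hx
    obtain ⟨-, hx'⟩ := hx'
    have e : ∀ (c : Vertex) (q : ZMod 6), tri (c + hexDir q) (q + 1 + 1) = tri c q := fun c q => by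
      rw [← tri_hexDir c q]; congr 1; ring
    obtain ⟨h2, h3⟩ := leaf_target_unique hT hA hx (by rw [e]; exact h1.1) (hw.outDeg_le hv) hx'
      (by rw [e]; exact h1'.1) (hw'.outDeg_le hv')
    have h3 := add_right_cancel h3
    rw [h3] at h2
    exact ⟨add_right_cancel h2, h3⟩
  · exact vertex_target_unique hT h1.1 h1.2 h1'.1 h1'.2 (hx.symm.trans hx')

/-! ### The free ends of leaves -/

theorem card_tri_eq (v : Vertex) (t : Triangle) :
    ({s | tri v s = t} : Finset (ZMod 6)).card = if v ∈ Triangle.vertices t then 1 else 0 := by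
  split_ifs with h
  · obtain ⟨s, rfl⟩ := exists_tri h
    rw [Finset.card_eq_one]
    refine ⟨s, ?_⟩
    ext r
    simp only [Finset.mem_filter, Finset.mem_univ, true_and, Finset.mem_singleton]
    exact (tri_injective v).eq_iff
  · rw [Finset.card_eq_zero, Finset.filter_eq_empty_iff]
    rintro s - rfl
    exact h (mem_tri v s)

theorem card_covers (A : Tile) (v : Vertex) :
    ({s | A.Covers (tri v s)} : Finset (ZMod 6)).card =
      (if v ∈ Triangle.vertices A.up then 1 else 0) +
        if v ∈ Triangle.vertices A.dn then 1 else 0 := by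
  simp only [covers_iff]
  rw [Finset.filter_or, Finset.card_union_of_disjoint, card_tri_eq, card_tri_eq]
  rw [Finset.disjoint_filter]
  rintro s - h1 h2
  exact upTri_ne_dnTri _ _ (h1.symm.trans h2)

/-- The angles of a tile at the two ends of a side add up to 180 degrees. -/
theorem card_covers_ends {A : Tile} {e : Edge} (he : e ∈ A.sides) :
    ({s | A.Covers (tri e.1 s)} : Finset (ZMod 6)).card +
      ({s | A.Covers (tri (Edge.tip e) s)} : Finset (ZMod 6)).card = 3 := by
  rw [card_covers, card_covers]
  obtain ⟨⟨a, b⟩, k⟩ := A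
  rw [Tile.sides] at he
  simp only [Finset.mem_insert, Finset.mem_singleton] at he
  rcases he with rfl | rfl | rfl | rfl <;> fin_cases k <;>
    simp [Edge.tip, Tile.up, Tile.dn, Tile.diag, Triangle.vertices, upTri, dnTri, upOff, dnOff, dir] <;>
    split_ifs <;> omega

/-- The side opposite to the only shared one: no shared side meets its ends, so `eq_of_free` applies
there. -/
theorem exists_free_side (hT : IsDokuTiling κ T) {A : Tile} (hA : A ∈ leaves T) :
    ∃ e ∈ A.sides, ∀ v ∈ ends e, ∀ r, Cov T (tri v r) → A.Covers (tri v r) := by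
  obtain ⟨hA, hc⟩ := (mem_leaves hT.no_overlap).mp hA
  obtain ⟨f, hf⟩ := Finset.card_eq_one.mp hc
  have hfA : f ∈ sharedSides T A := by rw [hf]; exact Finset.mem_singleton_self _
  have key : ∀ e ∈ A.sides, (∀ v ∈ ends e, v ∉ ends f) →
      ∀ v ∈ ends e, ∀ r, Cov T (tri v r) → A.Covers (tri v r) := by
    intro e he hef v hv r hr
    refine eq_of_free hT hA (ends_subset he hv) (fun s hs hcov => ?_) hr
    have : edgeAt v s ∈ sharedSides T A := mem_sharedSides.mpr ⟨hs, (cov_edgeAt T v s).mpr hcov⟩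
    rw [hf, Finset.mem_singleton] at this
    refine hef v hv ?_
    rw [← this, edgeAt_ends]
    exact Finset.mem_insert_self _ _
  obtain ⟨hk, h⟩ := (mem_sides_iff_uside A f).mp (mem_sharedSides.mp hfA).1
  rcases h with h | h
  · refine ⟨_, dside_mem hk, key _ (dside_mem hk) fun v hv => ?_⟩
    rw [h]; exact dside_ends hk hv
  · refine ⟨_, uside_mem hk, key _ (uside_mem hk) fun v hv => ?_⟩
    rw [h]; exact fun h' => dside_ends hk h' hv

theorem blocks_le_one (hT : IsDokuTiling κ T) (v : Vertex) : blocks T v ≤ 1 := by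
  refine Finset.card_le_one.mpr fun s hs s' hs' => ?_
  simp only [Finset.mem_filter, Finset.mem_univ, true_and] at hs hs'
  exact transition_unique hT hs.1 hs.2 hs'.1 hs'.2

theorem blocks_le_outDeg (T : Finset Tile) (v : Vertex) : blocks T v ≤ outDeg T v :=
  Finset.card_le_card fun s hs => by
    simp only [Finset.mem_filter, Finset.mem_univ, true_and] at hs ⊢
    exact hs.1

theorem four_mul_leaves_le (hT : IsDokuTiling κ T) :
    4 * (leaves T).card + 2 * ∑ v ∈ verts T, blocks T v ≤ ∑ v ∈ verts T, outDeg T v := by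
  have hO : NoOverlap T := hT.no_overlap
  have hle : ∀ A ∈ leaves T, A ∈ T := fun A hA => (Finset.mem_filter.mp hA).1
  have hex := fun A (hA : A ∈ leaves T) => exists_free_side hT hA
  have : Nonempty Edge := ⟨((0, 0), 0)⟩
  choose! g hg1 hg2 using hex
  -- The outer corners of leaves; each belongs to a single tile.
  set O : Finset Vertex := (leaves T).biUnion fun A => ends (g A) with hOdef
  have hOV : O ⊆ verts T := by
    intro v hv
    obtain ⟨A, hA, hv⟩ := Finset.mem_biUnion.mp hv
    exact mem_verts.mpr ⟨A, hle A hA, ends_subset (hg1 A hA) hv⟩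
  set W : Finset Vertex := {v ∈ verts T \ O | 3 ≤ outDeg T v} with hW
  set N : Finset Vertex := {v ∈ verts T \ O | outDeg T v = 1} with hN
  have hNW : N.card ≤ (leaves T).card + W.card := by
    have hex : ∀ v ∈ N, ∃ x ∈ (leaves T).disjSum W, Target T v x := by
      intro v hv
      obtain ⟨c, p, hv', hw, hp⟩ := exists_walk (Finset.mem_filter.mp hv).2
      obtain ⟨i, hwi, ⟨A, hA, hAc⟩ | ⟨h3, A, hA, hAl, hAc⟩⟩ := exists_target hT.no_holes hw hp
      · exact ⟨Sum.inl A, Finset.inl_mem_disjSum.mpr hA, c, p, i, hv', hwi, hA, hAc⟩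
      · refine ⟨Sum.inr (c + hexDir (p + i + 1)), Finset.inr_mem_disjSum.mpr ?_, c, p, i, hv', hwi,
          rfl⟩
        rw [← (tri_tip _ _).1] at hAc
        refine Finset.mem_filter.mpr ⟨Finset.mem_sdiff.mpr
          ⟨mem_verts_of_cov ⟨A, hA, hAc⟩, fun hO' => ?_⟩, h3⟩
        -- At an outer corner of a leaf that leaf is the only tile, but `A` is not a leaf.
        obtain ⟨B, hB, hv⟩ := Finset.mem_biUnion.mp hO'
        have := hO.unique hA (hle B hB) hAc (hg2 B hB _ hv _ ⟨A, hA, hAc⟩)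
        exact hAl (this ▸ hB)
    have : Nonempty (Tile ⊕ Vertex) := ⟨Sum.inr 0⟩
    choose! F hF1 hF2 using hex
    rw [← Finset.card_disjSum]
    refine Finset.card_le_card_of_injOn F hF1 fun v hv v' hv' h => ?_
    refine (hF2 v hv).unique hT (Finset.mem_filter.mp hv).2 (Finset.mem_filter.mp hv').2 ?_
    rw [h]; exact hF2 v' hv'
  set w : Vertex → ℤ := fun v => (outDeg T v : ℤ) - 2 * blocks T v with hw
  -- The leaf covers three of the twelve positions at its two outer corners, and there is at most
  -- one block at each: 12 - 3 - 2 * 2 = 5.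
  have hsumO : 5 * ((leaves T).card : ℤ) ≤ ∑ v ∈ O, w v := by
    rw [hOdef, Finset.sum_biUnion]
    · rw [mul_comm, ← nsmul_eq_mul]
      refine Finset.card_nsmul_le_sum _ _ _ fun A hA => ?_
      have hin : ∀ v ∈ ends (g A), inDeg T v =
          ({s | A.Covers (tri v s)} : Finset (ZMod 6)).card := fun v hv => by
        refine congrArg Finset.card (Finset.filter_congr fun s _ => ?_)
        exact ⟨hg2 A hA v hv s, fun h => ⟨A, hle A hA, h⟩⟩
      have hsum := card_covers_ends (hg1 A hA)
      rw [← hin _ (mem_ends.mpr (Or.inl rfl)), ← hin _ (mem_ends.mpr (Or.inr rfl))] at hsum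
      have e1 := inDeg_add_outDeg T (g A).1
      have e2 := inDeg_add_outDeg T (Edge.tip (g A))
      have b1 := blocks_le_one hT (g A).1
      have b2 := blocks_le_one hT (Edge.tip (g A))
      have : ∑ v ∈ ends (g A), w v = w (g A).1 + w (Edge.tip (g A)) :=
        Finset.sum_pair (Edge.tip_ne _)
      rw [this]
      simp only [hw]
      omega
    · intro A hA B hB hne
      refine Finset.disjoint_left.mpr fun v hv hv' => hne ?_
      obtain ⟨r, hr⟩ := (mem_vertices_iff_tri A v).mp (ends_subset (hg1 A hA) hv)
      exact hO.unique (hle A hA) (hle B hB) hr (hg2 B hB v hv' r ⟨A, hle A hA, hr⟩)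
  -- There is at most one block per vertex, and none without an uncovered triangle, so the weight is
  -- at least -1 at a notch, at least 1 on `W`, and nonnegative elsewhere.
  have hsumR : (W.card : ℤ) - N.card ≤ ∑ v ∈ verts T \ O, w v := by
    rw [hW, hN, Finset.card_filter, Finset.card_filter]
    push_cast
    rw [← Finset.sum_sub_distrib]
    refine Finset.sum_le_sum fun v _ => ?_
    have b1 := blocks_le_one hT v
    have b2 := blocks_le_outDeg T v
    simp only [hw]
    split_ifs <;> omega
  have htot : ∑ v ∈ verts T \ O, w v + ∑ v ∈ O, w v = ∑ v ∈ verts T, w v :=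
    Finset.sum_sdiff hOV
  have hsplit : ∑ v ∈ verts T, w v = ((∑ v ∈ verts T, outDeg T v : ℕ) : ℤ) -
      2 * ((∑ v ∈ verts T, blocks T v : ℕ) : ℤ) := by
    push_cast
    rw [Finset.mul_sum, ← Finset.sum_sub_distrib]
  omega

theorem leaves_card_le (hT : IsDokuTiling κ T) (hn : 2 ≤ T.card) :
    (leaves T).card ≤ numRuns T + 3 := by
  have h1 := sum_outDeg_le hT hn
  have h2 := le_sum_blocks hT hn
  have h3 := four_mul_leaves_le hT
  omega

theorem leaves_eq_zero (hn : T.card ≤ 1) : (leaves T).card = 0 := by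
  rw [Finset.card_eq_zero]
  refine Finset.filter_eq_empty_iff.mpr fun A hA h => ?_
  obtain ⟨B, hB⟩ := Finset.card_pos.mp (by rw [h]; exact one_pos)
  obtain ⟨hB, hAB⟩ := Finset.mem_filter.mp hB
  exact hAB.1 (Finset.card_le_one.mp hn A hA B hB)

end Doku

/-! ### Conclusion by parity -/

theorem mainTheorem11 (κ : ℕ) (hκ : 2 ≤ κ) (T : Finset Doku.Tile)
    (hT : Doku.IsDokuTiling κ T) :
    0 ≤ (Doku.leaves T).card ∧
      (Doku.leaves T).card ≤
        if Even κ ∧ Odd (Doku.numRuns T) then Doku.numRuns T + 3 else Doku.numRuns T + 2 := by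
  refine ⟨Nat.zero_le _, ?_⟩
  rcases Nat.lt_or_ge T.card 2 with hn | hn
  · rw [Doku.leaves_eq_zero (by omega)]
    exact Nat.zero_le _
  · have h1 := Doku.leaves_card_le hT hn
    have h2 := Doku.mul_numRuns_add hT hn
    split_ifs with h
    · exact h1
    · rcases Nat.lt_or_eq_of_le h1 with h3 | h3
      · omega
      -- With λ = ρ + 3 the flag count reads (κ + 1)ρ + 3 = 2n, which forces κ to be even and ρ odd.
      · exfalso
        rw [h3] at h2
        rw [Nat.odd_iff] at h
        obtain ⟨a, rfl | rfl⟩ := Nat.even_or_odd' κ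
        · have hr : Doku.numRuns T % 2 ≠ 1 := fun hr => h ⟨even_two_mul a, hr⟩
          rw [mul_assoc] at h2
          omega
        · rw [add_mul, mul_assoc, one_mul] at h2
          omega
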